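/- Let $k$ be a field and let $A$ be a finite dimensional differential graded $k$-algebra (cohomological grading) with $A^i=0$ for $i<0$, $A^0=k$, $A^1=0$ and $d:=\sup\{i\mid A^i\neq 0\}=\sup\{i\mid H^iA\neq 0\}$. Assume that $A$ is Gorenstein, i.e. $\operatorname{Hom}_k(H^*A,k)$ and $\Sigma^dH^*A$ are isomorphic as graded left $H^*A$-modules and as graded right $H^*A$-modules, and that $\dim_kH^*A\geq 2$. Let $\mathbf D(A)$ be the derived category of differential graded right $A$-modules, and for a differential graded module $C$ put $\sup C:=\sup\{i\mid C^i\neq0\}$. Fix an integer $e$. Put $C_0:=A$. Given $C_{n-1}$ with $n\geq1$, choose an integer $e_n$ and a cocycle $\zeta\in C_{n-1}^{e_n}$ with non-zero class in $H^{e_n}C_{n-1}$, and let $C_n$ be the mapping cone of the morphism $\Sigma^{-e_n}A\to C_{n-1}$, $1\mapsto\zeta$. Here the following choices of $e_n$ are allowed: - $e_n=\sup C_{n-1}$ (a construction step of the first kind); - $e_n=\sup C_{n-1}-d+e$ (a construction step of the second kind), provided that $2\leq e\leq d-2$, that $H^eA\neq0$, and that either $n=1$ or the $(n-1)$-th step was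 a step of the first kind. Put $e_n^A:=e_n-(\sup C_{n-1}-d)$, so that $e_n^A=d$ for a step of the first kind and $e_n^A=e$ for a step of the second kind. **Proposition 4.6.** Let $n\geq1$ and let $C_n$ be obtained from $A$ by $n$ such construction steps. Then the $k$-module $H^{e_n^A-1}A$ carries a bimodule structure over the $k$-algebra $\operatorname{End}_{\mathbf D(A)}(C_{n-1})$, compatible with its $k$-module structure, such that there is an isomorphism of $k$-algebras $$\operatorname{End}_{\mathbf D(A)}(C_n)\;\cong\;\operatorname{End}_{\mathbf D(A)}(C_{n-1})\ltimes H^{e_n^A-1}A$$ onto the trivial extension, whose first component sends $a\in\operatorname{End}_{\mathbf D(A)}(C_n)$ to an endomorphism $b$ of $C_{n-1}$ with $a\circ\iota=\iota\circ b$, where $\iota:C_{n-1}\to C_n$ is the canonical morphism. Moreover $\operatorname{End}_{\mathbf D(A)}(C_n)$ is a local ring, and $C_n$ is an indecomposable object of $\mathbf D(A)$. (Here the trivial extension $R\ltimes M$ of a ring $R$ by a bimodule $M$ is $R\times M$ with componentwise addition and $(r,m)(r',m')=(rr',mr'+rm')$.) -/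

import Mathlib

open CategoryTheory MulOpposite

universe u v

noncomputable section

/-- A differential graded `k`-algebra structure (cohomological grading by `ℤ`) on the
`k`-algebra `A`. -/
structure DGAlgebra (k : Type v) (A : Type u) [Field k] [Ring A] [Algebra k A] where
  /-- the homogeneous component `A^i` -/
  gr : ℤ → Submodule k A
  internal : DirectSum.IsInternal gr
  one_mem : (1 : A) ∈ gr 0
  mul_mem : ∀ {i j : ℤ} {a b : A}, a ∈ gr i → b ∈ gr j → a * b ∈ gr (i + j)
  /-- the differential -/
  d : A →ₗ[k] A
  d_mem : ∀ {i : ℤ} {a : A}, a ∈ gr i → d a ∈ gr (i + 1)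
  d_d : ∀ a : A, d (d a) = 0
  leibniz : ∀ {n : ℤ} {a : A} (b : A), a ∈ gr n →
    d (a * b) = d a * b + (n.negOnePow : ℤ) • (a * d b)

/-- A differential graded right module over a differential graded algebra `𝒜`: the right action
`x · a` is written `op a • x`. -/
structure DGModule {k : Type v} {A : Type u} [Field k] [Ring A] [Algebra k A]
    (𝒜 : DGAlgebra k A) where
  carrier : Type u
  [addCommGroup : AddCommGroup carrier]
  [moduleBase : Module k carrier]
  [moduleRight : Module Aᵐᵒᵖ carrier]
  [tower : IsScalarTower k Aᵐᵒᵖ carrier]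
  /-- the homogeneous component `M^i` -/
  gr : ℤ → Submodule k carrier
  internal : DirectSum.IsInternal gr
  smul_mem : ∀ {i j : ℤ} {x : carrier} {a : A}, x ∈ gr i → a ∈ 𝒜.gr j → op a • x ∈ gr (i + j)
  /-- the differential -/
  d : carrier →ₗ[k] carrier
  d_mem : ∀ {i : ℤ} {x : carrier}, x ∈ gr i → d x ∈ gr (i + 1)
  d_d : ∀ x : carrier, d (d x) = 0
  leibniz : ∀ {n : ℤ} {x : carrier} (a : A), x ∈ gr n →
    d (op a • x) = op a • d x + (n.negOnePow : ℤ) • (op (𝒜.d a) • x)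

namespace DGModule

variable {k : Type v} {A : Type u} [Field k] [Ring A] [Algebra k A] {𝒜 : DGAlgebra k A}

attribute [instance] addCommGroup moduleBase moduleRight tower

instance : CoeSort (DGModule 𝒜) (Type u) := ⟨carrier⟩

instance smulComm (M : DGModule 𝒜) : SMulCommClass Aᵐᵒᵖ k M := IsScalarTower.to_smulCommClass'

/-! ### Cohomology -/

/-- The `k`-module of cocycles of degree `i`. -/
def cocycles (M : DGModule 𝒜) (i : ℤ) : Submodule k M := M.gr i ⊓ LinearMap.ker M.d

/-- The `k`-module of coboundaries of degree `i`. -/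
def coboundaries (M : DGModule 𝒜) (i : ℤ) : Submodule k M := (M.gr (i - 1)).map M.d

/-- The `i`-th cohomology `H^i M`. -/
abbrev cohomology (M : DGModule 𝒜) (i : ℤ) : Type u :=
  M.cocycles i ⧸ (M.coboundaries i).submoduleOf (M.cocycles i)

/-- The cohomology class of a cocycle. -/
def cls (M : DGModule 𝒜) (i : ℤ) : M.cocycles i →ₗ[k] M.cohomology i :=
  ((M.coboundaries i).submoduleOf (M.cocycles i)).mkQ

/-- `sup M = sup {i | M^i ≠ 0}`. -/
def sup (M : DGModule 𝒜) : ℤ := sSup {i : ℤ | M.gr i ≠ ⊥}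

/-- `sup H^* M = sup {i | H^i M ≠ 0}`. -/
def supCohomology (M : DGModule 𝒜) : ℤ := sSup {i : ℤ | Nontrivial (M.cohomology i)}

/-! ### The category `C(A)` of differential graded modules -/

/-- The `k`-module of morphisms of differential graded modules: `A`-linear maps of degree `0`
that commute with the differentials. -/
def homSubmodule (M N : DGModule 𝒜) : Submodule k (M →ₗ[Aᵐᵒᵖ] N) where
  carrier := {f | (∀ i : ℤ, ∀ x ∈ M.gr i, f x ∈ N.gr i) ∧ ∀ x, f (M.d x) = N.d (f x)}
  add_mem' := by
    rintro f g ⟨hf, hf'⟩ ⟨hg, hg'⟩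
    exact ⟨fun i x hx => (N.gr i).add_mem (hf i x hx) (hg i x hx), fun x => by simp [hf', hg']⟩
  zero_mem' := ⟨fun i x _ => by simp, fun x => by simp⟩
  smul_mem' := by
    rintro c f ⟨hf, hf'⟩
    exact ⟨fun i x hx => (N.gr i).smul_mem c (hf i x hx), fun x => by simp [hf']⟩

/-- Morphisms of differential graded modules. -/
structure Hom (M N : DGModule 𝒜) where
  /-- the underlying map, with its properties -/
  toSub : homSubmodule M N

namespace Hom

variable {M N : DGModule 𝒜}

/-- The underlying `A`-linear map. -/
def lin (f : Hom M N) : M →ₗ[Aᵐᵒᵖ] N := f.toSub.1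

lemma map_mem (f : Hom M N) {i : ℤ} {x : M} (hx : x ∈ M.gr i) : f.lin x ∈ N.gr i :=
  f.toSub.2.1 i x hx

lemma comm (f : Hom M N) (x : M) : f.lin (M.d x) = N.d (f.lin x) := f.toSub.2.2 x

/-- Build a morphism from an `A`-linear map. -/
def ofLin (f : M →ₗ[Aᵐᵒᵖ] N) (h : ∀ i : ℤ, ∀ x ∈ M.gr i, f x ∈ N.gr i)
    (h' : ∀ x, f (M.d x) = N.d (f x)) : Hom M N := ⟨⟨f, h, h'⟩⟩

@[simp] lemma ofLin_lin (f : M →ₗ[Aᵐᵒᵖ] N) (h h') : (ofLin f h h').lin = f := rfl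

@[ext] lemma ext {f g : Hom M N} (h : f.lin = g.lin) : f = g := by
  obtain ⟨⟨f, hf⟩⟩ := f
  obtain ⟨⟨g, hg⟩⟩ := g
  cases (show f = g from h)
  rfl

lemma map_smul_base (f : Hom M N) (c : k) (x : M) : f.lin (c • x) = c • f.lin x := by
  have h1 : c • x = (algebraMap k Aᵐᵒᵖ c) • x := (algebraMap_smul _ c x).symm
  rw [h1, map_smul, algebraMap_smul]

/-- `Hom` is in bijection with the submodule of morphisms. -/
def equiv (M N : DGModule 𝒜) : Hom M N ≃ homSubmodule M N where
  toFun := toSub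
  invFun := mk

instance : AddCommGroup (Hom M N) := (equiv M N).addCommGroup

instance : Module k (Hom M N) := (equiv M N).module k

@[simp] lemma add_lin (f g : Hom M N) : (f + g).lin = f.lin + g.lin := rfl
@[simp] lemma sub_lin (f g : Hom M N) : (f - g).lin = f.lin - g.lin := rfl
@[simp] lemma zero_lin : (0 : Hom M N).lin = 0 := rfl
@[simp] lemma smul_lin (c : k) (f : Hom M N) : (c • f).lin = c • f.lin := rfl

end Hom

/-- The category `C(A)`. -/
instance : Category (DGModule 𝒜) where
  Hom M N := Hom M N
  id M := Hom.ofLin LinearMap.id (fun _ _ h => h) (fun _ => rfl)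
  comp f g := Hom.ofLin (g.lin ∘ₗ f.lin) (fun _ _ h => g.map_mem (f.map_mem h))
    (fun x => by simp [f.comm, g.comm])

/-- The underlying `A`-linear map of a morphism. -/
abbrev lin {M N : DGModule 𝒜} (f : M ⟶ N) : M →ₗ[Aᵐᵒᵖ] N := Hom.lin f

lemma hom_ext {M N : DGModule 𝒜} {f g : M ⟶ N} (h : ∀ x, lin f x = lin g x) : f = g :=
  Hom.ext (LinearMap.ext h)

@[simp] lemma id_lin (M : DGModule 𝒜) (x : M) : lin (𝟙 M) x = x := rfl
@[simp] lemma comp_lin {M N P : DGModule 𝒜} (f : M ⟶ N) (g : N ⟶ P) (x : M) :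
    lin (f ≫ g) x = lin g (lin f x) := rfl

instance : Preadditive (DGModule 𝒜) where
  homGroup M N := inferInstanceAs (AddCommGroup (Hom M N))
  add_comp _ _ _ f f' g := hom_ext fun x => map_add (lin g) (lin f x) (lin f' x)
  comp_add _ _ _ _ _ _ := rfl

instance : Linear k (DGModule 𝒜) where
  homModule M N := inferInstanceAs (Module k (Hom M N))
  smul_comp _ _ _ c f g := hom_ext fun x => Hom.map_smul_base g c (lin f x)
  comp_smul _ _ _ _ _ _ := rfl

@[simp] lemma add_lin {M N : DGModule 𝒜} (f g : M ⟶ N) (x : M) :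
    lin (f + g) x = lin f x + lin g x := rfl
@[simp] lemma sub_lin {M N : DGModule 𝒜} (f g : M ⟶ N) (x : M) :
    lin (f - g) x = lin f x - lin g x := rfl
@[simp] lemma smul_lin {M N : DGModule 𝒜} (c : k) (f : M ⟶ N) (x : M) :
    lin (c • f) x = c • lin f x := rfl

/-! ### The homotopy category `H(A)` -/

/-- Two morphisms are homotopic if their difference is `d h + h d` for some `A`-linear map `h` of
degree `-1`. -/
def Homotopic : HomRel (DGModule 𝒜) := fun M N f g =>
  ∃ h : M →ₗ[Aᵐᵒᵖ] N, (∀ i : ℤ, ∀ x ∈ M.gr i, h x ∈ N.gr (i - 1)) ∧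
    ∀ x, lin f x - lin g x = N.d (h x) + h (M.d x)

lemma Homotopic.add {M N : DGModule 𝒜} (f₁ f₂ g₁ g₂ : M ⟶ N) :
    Homotopic f₁ f₂ → Homotopic g₁ g₂ → Homotopic (f₁ + g₁) (f₂ + g₂) := by
  rintro ⟨h, hm, hh⟩ ⟨h', hm', hh'⟩
  refine ⟨h + h', fun i x hx => Submodule.add_mem _ (hm i x hx) (hm' i x hx), fun x => ?_⟩
  have e : lin (f₁ + g₁) x - lin (f₂ + g₂) x
      = (lin f₁ x - lin f₂ x) + (lin g₁ x - lin g₂ x) := by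
    simp only [add_lin]; abel
  rw [e, hh, hh']
  simp only [LinearMap.add_apply, map_add]; abel

lemma Homotopic.smul (c : k) {M N : DGModule 𝒜} (f g : M ⟶ N) :
    Homotopic f g → Homotopic (c • f) (c • g) := by
  rintro ⟨h, hm, hh⟩
  refine ⟨c • h, fun i x hx => Submodule.smul_mem _ c (hm i x hx), fun x => ?_⟩
  have e : lin (c • f) x - lin (c • g) x = c • (lin f x - lin g x) := by
    simp only [smul_lin, smul_sub]
  rw [e, hh]
  simp only [LinearMap.smul_apply, map_smul, smul_add]

instance : Congruence (Homotopic (𝒜 := 𝒜)) where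
  equivalence := by
    refine ⟨fun f => ⟨0, fun i x _ => Submodule.zero_mem _, fun x => by simp⟩, ?_, ?_⟩
    · rintro f g ⟨h, hm, hh⟩
      refine ⟨-h, fun i x hx => Submodule.neg_mem _ (hm i x hx), fun x => ?_⟩
      rw [← neg_sub, hh]
      simp only [LinearMap.neg_apply, map_neg]; abel
    · rintro f g l ⟨h, hm, hh⟩ ⟨h', hm', hh'⟩
      refine ⟨h + h', fun i x hx => Submodule.add_mem _ (hm i x hx) (hm' i x hx), fun x => ?_⟩
      rw [← sub_add_sub_cancel _ (lin g x), hh, hh']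
      simp only [LinearMap.add_apply, map_add]; abel
  comp_left := by
    rintro M N P f g g' ⟨h, hm, hh⟩
    refine ⟨h ∘ₗ lin f, fun i x hx => hm i _ (Hom.map_mem f hx), fun x => ?_⟩
    simp only [comp_lin, hh, LinearMap.comp_apply, Hom.comm f]
  comp_right := by
    rintro M N P f f' g ⟨h, hm, hh⟩
    refine ⟨lin g ∘ₗ h, fun i x hx => Hom.map_mem g (hm i x hx), fun x => ?_⟩
    simp only [comp_lin, ← map_sub, hh, LinearMap.comp_apply, map_add, Hom.comm g]

variable (𝒜) in
/-- The homotopy category `H(A)`. -/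
abbrev HomotopyCat := Quotient (Homotopic (𝒜 := 𝒜))

variable (𝒜) in
/-- The functor `C(A) ⥤ H(A)`. -/
abbrev toHomotopyCat : DGModule 𝒜 ⥤ HomotopyCat 𝒜 := Quotient.functor _

instance : Preadditive (HomotopyCat 𝒜) :=
  Quotient.preadditive _ fun _ _ _ _ _ _ h h' => Homotopic.add _ _ _ _ h h'

instance : (toHomotopyCat 𝒜).Additive :=
  Quotient.functor_additive _ fun _ _ _ _ _ _ h h' => Homotopic.add _ _ _ _ h h'

instance : Linear k (HomotopyCat 𝒜) :=
  Quotient.linear k _ fun c _ _ _ _ h => Homotopic.smul c _ _ h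

/-! ### Shifts and mapping cones -/

/-- The shift `Σ^n M`: `(Σ^n M)^i = M^{i+n}`, with differential `(-1)^n d`. -/
@[reducible] def shift (n : ℤ) (M : DGModule 𝒜) : DGModule 𝒜 where
  carrier := M
  gr i := M.gr (i + n)
  internal := by
    have h := M.internal
    rw [DirectSum.isInternal_submodule_iff_iSupIndep_and_iSup_eq_top] at h ⊢
    exact ⟨h.1.comp (add_left_injective n), by
      rw [← h.2]; exact (Equiv.addRight n).iSup_comp (g := M.gr)⟩
  smul_mem {i j x a} hx ha := by
    have := M.smul_mem hx ha
    rwa [add_right_comm] at this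
  d := (n.negOnePow : ℤ) • M.d
  d_mem {i x} hx := by
    have := M.d_mem hx
    rw [add_right_comm] at this
    exact zsmul_mem this _
  d_d x := by
    change (n.negOnePow : ℤ) • M.d ((n.negOnePow : ℤ) • M.d x) = 0
    rw [map_zsmul, M.d_d, smul_zero, smul_zero]
  leibniz {m x} a hx := by
    simp only [LinearMap.smul_apply, M.leibniz a hx, smul_add, Int.negOnePow_add, Units.val_mul,
      smul_smul]
    congr 1
    · rw [smul_comm]
    · congr 1
      have : ((n.negOnePow : ℤˣ) : ℤ) * ((n.negOnePow : ℤˣ) : ℤ) = 1 := by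
        rw [← Units.val_mul, Int.units_mul_self, Units.val_one]
      rw [mul_comm, mul_assoc, this, mul_one]

/-- The mapping cone of `f : M ⟶ N`: the graded module `ΣM ⊕ N` with differential
`(x, y) ↦ (-d x, f x + d y)`. -/
@[reducible] def cone {M N : DGModule 𝒜} (f : M ⟶ N) : DGModule 𝒜 where
  carrier := M × N
  gr i := (M.gr (i + 1)).prod (N.gr i)
  internal := by
    have hM := M.internal
    have hN := N.internal
    rw [DirectSum.isInternal_submodule_iff_iSupIndep_and_iSup_eq_top] at hM hN ⊢
    have hM1 : iSupIndep fun i : ℤ => M.gr (i + 1) := hM.1.comp (add_left_injective 1)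
    have hM2 : ⨆ i : ℤ, M.gr (i + 1) = ⊤ := by
      rw [← hM.2]; exact (Equiv.addRight (1 : ℤ)).iSup_comp (g := M.gr)
    constructor
    · intro i
      have hle : (⨆ (j : ℤ) (_ : j ≠ i), (M.gr (j + 1)).prod (N.gr j)) ≤
          (⨆ (j : ℤ) (_ : j ≠ i), M.gr (j + 1)).prod (⨆ (j : ℤ) (_ : j ≠ i), N.gr j) :=
        iSup₂_le fun j hj => Submodule.prod_mono
          (le_iSup₂ (f := fun (j : ℤ) (_ : j ≠ i) => M.gr (j + 1)) j hj)
          (le_iSup₂ (f := fun (j : ℤ) (_ : j ≠ i) => N.gr j) j hj)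
      refine Disjoint.mono_right hle ?_
      rw [Submodule.disjoint_def]
      rintro ⟨x, y⟩ ⟨hx, hy⟩ ⟨hx', hy'⟩
      exact Prod.ext ((Submodule.disjoint_def.1 (hM1 i)) x hx hx')
        ((Submodule.disjoint_def.1 (hN.1 i)) y hy hy')
    · rw [eq_top_iff]
      rintro ⟨x, y⟩ -
      have h1 : Submodule.map (LinearMap.inl k M N) ⊤ ≤
          ⨆ i : ℤ, (M.gr (i + 1)).prod (N.gr i) := by
        rw [← hM2, Submodule.map_iSup]
        refine iSup_mono fun i => ?_
        rintro _ ⟨z, hz, rfl⟩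
        exact ⟨hz, Submodule.zero_mem _⟩
      have h2 : Submodule.map (LinearMap.inr k M N) ⊤ ≤
          ⨆ i : ℤ, (M.gr (i + 1)).prod (N.gr i) := by
        rw [← hN.2, Submodule.map_iSup]
        refine iSup_mono fun i => ?_
        rintro _ ⟨z, hz, rfl⟩
        exact ⟨Submodule.zero_mem _, hz⟩
      have := Submodule.add_mem _ (h1 ⟨x, trivial, rfl⟩) (h2 ⟨y, trivial, rfl⟩)
      simpa using this
  smul_mem {i j x a} hx ha := by
    refine ⟨?_, N.smul_mem hx.2 ha⟩
    have := M.smul_mem hx.1 ha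
    rwa [add_right_comm] at this
  d :=
    { toFun := fun p => (-M.d p.1, lin f p.1 + N.d p.2)
      map_add' := fun p q => by
        ext
        · simp only [Prod.fst_add, map_add, neg_add]
        · simp only [Prod.fst_add, Prod.snd_add, map_add]; abel
      map_smul' := fun c p => by
        ext
        · simp
        · simp [Hom.map_smul_base f] }
  d_mem {i x} hx := by
    refine ⟨Submodule.neg_mem _ (M.d_mem hx.1), ?_⟩
    exact Submodule.add_mem _ (Hom.map_mem f hx.1) (N.d_mem hx.2)
  d_d x := by
    ext
    · simp [M.d_d]
    · simp [N.d_d, Hom.comm f]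
  leibniz {n x} a hx := by
    have h1 := M.leibniz a hx.1
    have h2 := N.leibniz a hx.2
    ext
    · simp only [LinearMap.coe_mk, AddHom.coe_mk, Prod.smul_fst, Prod.fst_add, h1,
        Int.negOnePow_succ, Units.val_neg, neg_smul, neg_add, neg_neg, smul_neg]
    · simp only [LinearMap.coe_mk, AddHom.coe_mk, Prod.smul_snd, Prod.smul_fst, Prod.snd_add, h2,
        map_smul, smul_add, add_assoc]

/-- The inclusion `N ⟶ cone f`. -/
@[reducible] def coneInr {M N : DGModule 𝒜} (f : M ⟶ N) : N ⟶ cone f :=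
  Hom.ofLin (LinearMap.inr Aᵐᵒᵖ M N) (fun _ _ hx => ⟨Submodule.zero_mem _, hx⟩)
    (fun x => by
      change ((0 : M), N.d x) = (-M.d 0, lin f 0 + N.d x)
      simp)

/-! ### Quasi-isomorphisms and the derived category `D(A)` -/

lemma map_cocycles {M N : DGModule 𝒜} (f : M ⟶ N) (i : ℤ) {x : M} (hx : x ∈ M.cocycles i) :
    lin f x ∈ N.cocycles i :=
  ⟨Hom.map_mem f hx.1, by
    have h : M.d x = 0 := hx.2
    change N.d (lin f x) = 0
    rw [← Hom.comm f, h, map_zero]⟩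

lemma map_coboundaries {M N : DGModule 𝒜} (f : M ⟶ N) (i : ℤ) {x : M}
    (hx : x ∈ M.coboundaries i) : lin f x ∈ N.coboundaries i := by
  obtain ⟨y, hy, rfl⟩ := hx
  exact ⟨lin f y, Hom.map_mem f hy, (Hom.comm f y).symm⟩

/-- The map induced by a morphism on cocycles. -/
def cocyclesMap {M N : DGModule 𝒜} (f : M ⟶ N) (i : ℤ) : M.cocycles i →ₗ[k] N.cocycles i where
  toFun x := ⟨lin f x, map_cocycles f i x.2⟩
  map_add' x y := Subtype.ext (map_add (lin f) (x : M) (y : M))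
  map_smul' c x := Subtype.ext (Hom.map_smul_base f c (x : M))

/-- The map induced by a morphism on cohomology. -/
def cohomologyMap {M N : DGModule 𝒜} (f : M ⟶ N) (i : ℤ) :
    M.cohomology i →ₗ[k] N.cohomology i :=
  Submodule.mapQ _ _ (cocyclesMap f i) fun _ hx => map_coboundaries f i hx

lemma cls_eq_zero_iff {M : DGModule 𝒜} {i : ℤ} (x : M.cocycles i) :
    M.cls i x = 0 ↔ (x : M) ∈ M.coboundaries i :=
  Submodule.Quotient.mk_eq_zero _

lemma cls_surjective {M : DGModule 𝒜} (i : ℤ) : Function.Surjective (M.cls i) :=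
  Submodule.mkQ_surjective _

lemma cohomologyMap_cls {M N : DGModule 𝒜} (f : M ⟶ N) (i : ℤ) (x : M.cocycles i) :
    cohomologyMap f i (M.cls i x) = N.cls i (cocyclesMap f i x) := rfl

/-- A quasi-isomorphism is a morphism that induces an isomorphism in cohomology. -/
def IsQuasiIso {M N : DGModule 𝒜} (f : M ⟶ N) : Prop :=
  ∀ i : ℤ, Function.Bijective (cohomologyMap f i)

lemma isQuasiIso_iff {M N : DGModule 𝒜} (f : M ⟶ N) : IsQuasiIso f ↔
    ∀ i : ℤ, (∀ x ∈ M.cocycles i, lin f x ∈ N.coboundaries i → x ∈ M.coboundaries i) ∧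
      ∀ y ∈ N.cocycles i, ∃ x ∈ M.cocycles i, y - lin f x ∈ N.coboundaries i := by
  refine forall_congr' fun i => and_congr ?_ ?_
  · rw [injective_iff_map_eq_zero]
    constructor
    · intro h x hx hfx
      have h0 : cohomologyMap f i (M.cls i ⟨x, hx⟩) = 0 := by
        rw [cohomologyMap_cls, cls_eq_zero_iff]; exact hfx
      exact (cls_eq_zero_iff _).1 (h _ h0)
    · intro h x hx
      obtain ⟨x, rfl⟩ := cls_surjective i x
      rw [cohomologyMap_cls, cls_eq_zero_iff] at hx
      exact (cls_eq_zero_iff _).2 (h x x.2 hx)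
  · constructor
    · intro h y hy
      obtain ⟨x, hx⟩ := h (N.cls i ⟨y, hy⟩)
      obtain ⟨x, rfl⟩ := cls_surjective i x
      rw [cohomologyMap_cls] at hx
      have h0 : N.cls i (⟨y, hy⟩ - cocyclesMap f i x) = 0 := by rw [map_sub, hx, sub_self]
      exact ⟨x, x.2, (cls_eq_zero_iff _).1 h0⟩
    · intro h y
      obtain ⟨y, rfl⟩ := cls_surjective i y
      obtain ⟨x, hx, hxy⟩ := h y y.2
      refine ⟨M.cls i ⟨x, hx⟩, ?_⟩
      rw [cohomologyMap_cls, eq_comm, ← sub_eq_zero, ← map_sub]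
      exact (cls_eq_zero_iff _).2 hxy

lemma Homotopic.sub_mem {M N : DGModule 𝒜} {f g : M ⟶ N} (h : Homotopic f g) {i : ℤ} {x : M}
    (hx : x ∈ M.cocycles i) : lin f x - lin g x ∈ N.coboundaries i := by
  obtain ⟨h, hm, hh⟩ := h
  have hx0 : M.d x = 0 := hx.2
  rw [hh, hx0, map_zero, add_zero]
  exact ⟨h x, hm i x hx.1, rfl⟩

lemma IsQuasiIso.of_homotopic {M N : DGModule 𝒜} {f g : M ⟶ N} (h : Homotopic f g)
    (hf : IsQuasiIso f) : IsQuasiIso g := by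
  rw [isQuasiIso_iff] at hf ⊢
  refine fun i => ⟨fun x hx hgx => (hf i).1 x hx ?_, fun y hy => ?_⟩
  · have := Submodule.add_mem _ (h.sub_mem hx) hgx
    simpa using this
  · obtain ⟨x, hx, hxy⟩ := (hf i).2 y hy
    refine ⟨x, hx, ?_⟩
    have := Submodule.add_mem _ hxy (h.sub_mem hx)
    simpa using this

lemma IsQuasiIso.comp {M N P : DGModule 𝒜} {f : M ⟶ N} {g : N ⟶ P} (hf : IsQuasiIso f)
    (hg : IsQuasiIso g) : IsQuasiIso (f ≫ g) := by
  rw [isQuasiIso_iff] at *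
  refine fun i => ⟨fun x hx h => (hf i).1 x hx ((hg i).1 _ (map_cocycles f i hx) h),
    fun z hz => ?_⟩
  obtain ⟨y, hy, hyz⟩ := (hg i).2 z hz
  obtain ⟨x, hx, hxy⟩ := (hf i).2 y hy
  refine ⟨x, hx, ?_⟩
  have := Submodule.add_mem _ hyz (map_coboundaries g i hxy)
  simpa using this

lemma IsQuasiIso.id (M : DGModule 𝒜) : IsQuasiIso (𝟙 M) := by
  rw [isQuasiIso_iff]
  exact fun i => ⟨fun x _ h => h, fun y hy => ⟨y, hy, by simp⟩⟩

variable (𝒜) in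
/-- The class of quasi-isomorphisms in `H(A)`. -/
def quasiIso : MorphismProperty (HomotopyCat 𝒜) := fun X Y f =>
  ∃ g : X.as ⟶ Y.as, (toHomotopyCat 𝒜).map g = f ∧ IsQuasiIso g

lemma quasiIso_map_iff {M N : DGModule 𝒜} (f : M ⟶ N) :
    quasiIso 𝒜 ((toHomotopyCat 𝒜).map f) ↔ IsQuasiIso f := by
  constructor
  · rintro ⟨g, hg, hg'⟩
    exact hg'.of_homotopic ((Quotient.functor_map_eq_iff _ _ _).1 hg)
  · exact fun h => ⟨f, rfl, h⟩

instance : (quasiIso 𝒜).IsMultiplicative where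
  id_mem X := ⟨𝟙 X.as, rfl, IsQuasiIso.id _⟩
  comp_mem := by
    rintro X Y Z _ _ ⟨f, rfl, hf⟩ ⟨g, rfl, hg⟩
    exact ⟨f ≫ g, rfl, hf.comp hg⟩

/-- A differential graded module is acyclic if every cocycle is a coboundary. -/
def Acyclic (M : DGModule 𝒜) : Prop := ∀ i : ℤ, M.cocycles i ≤ M.coboundaries i

lemma acyclic_cone {M N : DGModule 𝒜} {f : M ⟶ N} (hf : IsQuasiIso f) : Acyclic (cone f) := by
  rw [isQuasiIso_iff] at hf
  rintro i ⟨x, y⟩ ⟨⟨hx, hy⟩, hxy⟩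
  have hxy' : ((-M.d x, lin f x + N.d y) : M × N) = 0 := hxy
  have h1 : M.d x = 0 := neg_eq_zero.1 (congrArg Prod.fst hxy')
  have h2 : lin f x + N.d y = 0 := congrArg Prod.snd hxy'
  obtain ⟨w, hw, rfl⟩ := (hf (i + 1)).1 x ⟨hx, h1⟩ ⟨-y, by
    rw [add_sub_cancel_right]; exact Submodule.neg_mem _ hy, by
    rw [map_neg]; exact (eq_neg_of_add_eq_zero_left h2).symm⟩
  rw [add_sub_cancel_right] at hw
  have hc : y + lin f w ∈ N.cocycles i :=
    ⟨Submodule.add_mem _ hy (Hom.map_mem f hw), by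
      change N.d (y + lin f w) = 0
      rw [map_add, ← Hom.comm f, add_comm]; exact h2⟩
  obtain ⟨c, hc, b, hb, hbc⟩ := (hf i).2 _ hc
  refine ⟨(c - w, b), ⟨?_, hb⟩, ?_⟩
  · change c - w ∈ M.gr (i - 1 + 1)
    rw [sub_add_cancel]
    exact Submodule.sub_mem _ hc.1 hw
  · have hc0 : M.d c = 0 := hc.2
    change ((-M.d (c - w), lin f (c - w) + N.d b) : M × N) = (M.d w, y)
    rw [hbc, map_sub, map_sub, hc0]
    ext
    · simp
    · simp

lemma isQuasiIso_coneInr {M N : DGModule 𝒜} (f : M ⟶ N) (hM : Acyclic M) :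
    IsQuasiIso (coneInr f) := by
  rw [isQuasiIso_iff]
  refine fun i => ⟨?_, ?_⟩
  · rintro y hy ⟨⟨x, y0⟩, ⟨hx, hy0⟩, hd⟩
    have hd' : ((-M.d x, lin f x + N.d y0) : M × N) = (0, y) := hd
    have h1 : M.d x = 0 := neg_eq_zero.1 (congrArg Prod.fst hd')
    have h2 : lin f x + N.d y0 = y := congrArg Prod.snd hd'
    obtain ⟨w, hw, rfl⟩ := hM _ ⟨hx, h1⟩
    rw [add_sub_cancel_right] at hw
    exact ⟨lin f w + y0, Submodule.add_mem _ (Hom.map_mem f hw) hy0, by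
      rw [map_add, ← Hom.comm f, h2]⟩
  · rintro ⟨x, y⟩ ⟨⟨hx, hy⟩, hd⟩
    have hd' : ((-M.d x, lin f x + N.d y) : M × N) = 0 := hd
    have h1 : M.d x = 0 := neg_eq_zero.1 (congrArg Prod.fst hd')
    have h2 : lin f x + N.d y = 0 := congrArg Prod.snd hd'
    obtain ⟨w, hw, rfl⟩ := hM _ ⟨hx, h1⟩
    rw [add_sub_cancel_right] at hw
    refine ⟨y + lin f w, ⟨Submodule.add_mem _ hy (Hom.map_mem f hw), ?_⟩,
      (-w, 0), ⟨?_, Submodule.zero_mem _⟩, ?_⟩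
    · change N.d (y + lin f w) = 0
      rw [map_add, ← Hom.comm f, add_comm]; exact h2
    · change -w ∈ M.gr (i - 1 + 1)
      rw [sub_add_cancel]
      exact Submodule.neg_mem _ hw
    · change ((-M.d (-w), lin f (-w) + N.d 0) : M × N) = (M.d w - 0, y - (y + lin f w))
      ext
      · simp
      · simp

lemma Acyclic.shift {M : DGModule 𝒜} (hM : Acyclic M) (n : ℤ) : Acyclic (M.shift n) := by
  rintro i x ⟨hx, hd⟩
  have hu : ((n.negOnePow : ℤˣ) : ℤ) * ((n.negOnePow : ℤˣ) : ℤ) = 1 := by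
    rw [← Units.val_mul, Int.units_mul_self, Units.val_one]
  have hd' : (n.negOnePow : ℤ) • M.d x = 0 := hd
  have h0 : M.d x = 0 := by
    have := congrArg (fun z => (n.negOnePow : ℤ) • z) hd'
    simpa only [smul_smul, hu, one_smul, smul_zero] using this
  obtain ⟨w, hw, hwx⟩ := hM (i + n) ⟨hx, h0⟩
  refine ⟨(n.negOnePow : ℤ) • w, ?_, ?_⟩
  · refine zsmul_mem ?_ _
    change w ∈ M.gr (i - 1 + n)
    rwa [sub_add_eq_add_sub]
  · change (n.negOnePow : ℤ) • M.d ((n.negOnePow : ℤ) • w) = x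
    rw [map_zsmul, smul_smul, hu, one_smul, hwx]

lemma quasiIso_exists_leftFraction {M' M N : DGModule 𝒜} (s : M' ⟶ M) (hs : IsQuasiIso s)
    (f : M' ⟶ N) : ∃ (P : DGModule 𝒜) (g : M ⟶ P) (t : N ⟶ P), IsQuasiIso t ∧
      Homotopic (f ≫ t) (s ≫ g) := by
  let K : DGModule 𝒜 := (cone s).shift (-1)
  have hK : Acyclic K := (acyclic_cone hs).shift (-1)
  have hKd : ∀ p : M' × M, K.d p = ((M'.d p.1, -lin s p.1 - M.d p.2) : M' × M) := by
    intro p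
    change (((-1 : ℤ).negOnePow : ℤˣ) : ℤ) • ((-M'.d p.1, lin s p.1 + M.d p.2) : M' × M) = _
    ext
    · simp
    · simp; abel
  let q : K ⟶ N := Hom.ofLin (lin f ∘ₗ LinearMap.fst Aᵐᵒᵖ M' M)
    (fun i x hx => Hom.map_mem f (by
      have h1 : x.1 ∈ M'.gr (i + -1 + 1) := hx.1
      rwa [neg_add_cancel_right] at h1))
    (fun x => (congrArg (fun p : M' × M => lin f p.1) (hKd x)).trans (Hom.comm f x.1))
  refine ⟨cone q, Hom.ofLin
    (-(LinearMap.inl Aᵐᵒᵖ (M' × M) N ∘ₗ LinearMap.inr Aᵐᵒᵖ M' M)) ?_ ?_,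
    coneInr q, isQuasiIso_coneInr q hK, ?_⟩
  · intro i x hx
    refine Submodule.neg_mem _ ⟨⟨Submodule.zero_mem _, ?_⟩, Submodule.zero_mem _⟩
    change x ∈ M.gr (i + 1 + -1)
    simpa using hx
  · intro x
    change (-(((0 : M'), M.d x), (0 : N)) : (M' × M) × N)
      = (-K.d (-((0 : M'), x)), lin f (-(0 : M')) + N.d (-(0 : N)))
    rw [hKd]
    refine Prod.ext (Prod.ext ?_ ?_) ?_
    · change -(0 : M') = -M'.d (-0)
      simp
    · change -M.d x = -(-lin s (-0) - M.d (-x))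
      simp
    · change -(0 : N) = lin f (-0) + N.d (-0)
      simp
  · refine ⟨LinearMap.inl Aᵐᵒᵖ (M' × M) N ∘ₗ LinearMap.inl Aᵐᵒᵖ M' M, ?_, ?_⟩
    · intro i x hx
      refine ⟨⟨?_, Submodule.zero_mem _⟩, Submodule.zero_mem _⟩
      change x ∈ M'.gr (i - 1 + 1 + -1 + 1)
      simpa using hx
    · intro x
      change ((((0 : M'), (0 : M)), lin f x) : (M' × M) × N) - (-(((0 : M'), lin s x), (0 : N)))
        = ((-K.d (x, (0 : M)), lin f x + N.d (0 : N)) : (M' × M) × N)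
          + (((M'.d x, (0 : M)), (0 : N)) : (M' × M) × N)
      rw [hKd]
      refine Prod.ext (Prod.ext ?_ ?_) ?_
      · change (0 : M') - -0 = -M'.d x + M'.d x
        simp
      · change (0 : M) - -lin s x = -(-lin s x - M.d 0) + 0
        simp
      · change lin f x - -0 = lin f x + N.d 0 + 0
        simp

lemma quasiIso_ext {M' M N : DGModule 𝒜} (f₁ f₂ : M ⟶ N) (s : M' ⟶ M) (hs : IsQuasiIso s)
    (h : Homotopic (s ≫ f₁) (s ≫ f₂)) : ∃ (P : DGModule 𝒜) (t : N ⟶ P), IsQuasiIso t ∧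
      Homotopic (f₁ ≫ t) (f₂ ≫ t) := by
  obtain ⟨h, hm, hh⟩ := h
  let g : M ⟶ N := f₁ - f₂
  have hg : ∀ x, lin g x = lin f₁ x - lin f₂ x := fun _ => rfl
  let q : cone s ⟶ N := Hom.ofLin (LinearMap.coprod h (lin g))
    (fun i x hx => by
      refine Submodule.add_mem _ ?_ (Hom.map_mem g hx.2)
      have h1 := hm _ _ hx.1
      rwa [add_sub_cancel_right] at h1)
    (fun x => by
      change h (-M'.d x.1) + lin g (lin s x.1 + M.d x.2) = N.d (h x.1 + lin g x.2)
      have e := hh x.1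
      simp only [comp_lin] at e
      rw [map_neg, map_add, map_add, Hom.comm g, hg (lin s x.1), e]
      abel)
  refine ⟨cone q, coneInr q, isQuasiIso_coneInr q (acyclic_cone hs), ?_⟩
  refine ⟨LinearMap.inl Aᵐᵒᵖ (M' × M) N ∘ₗ LinearMap.inr Aᵐᵒᵖ M' M, ?_, ?_⟩
  · intro i x hx
    refine ⟨⟨Submodule.zero_mem _, ?_⟩, Submodule.zero_mem _⟩
    change x ∈ M.gr (i - 1 + 1)
    simpa using hx
  · intro x
    change (((0 : M' × M), lin f₁ x) : (M' × M) × N) - ((0 : M' × M), lin f₂ x)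
      = ((-((-M'.d 0, lin s 0 + M.d x) : M' × M), h 0 + lin g x + N.d 0) : (M' × M) × N)
        + ((((0 : M'), M.d x), (0 : N)) : (M' × M) × N)
    rw [hg]
    ext
    · simp
    · simp
    · simp

instance : (quasiIso 𝒜).HasLeftCalculusOfFractions where
  exists_leftFraction := by
    rintro X Y ⟨s, ⟨s, rfl, hs⟩, f⟩
    obtain ⟨f, rfl⟩ := (toHomotopyCat 𝒜).map_surjective f
    obtain ⟨P, g, t, ht, h⟩ := quasiIso_exists_leftFraction s hs f
    exact ⟨⟨(toHomotopyCat 𝒜).map g, (toHomotopyCat 𝒜).map t, (quasiIso_map_iff t).2 ht⟩,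
      CategoryTheory.Quotient.sound _ h⟩
  ext := by
    rintro X' X Y f₁ f₂ s ⟨s, rfl, hs⟩ h
    obtain ⟨f₁, rfl⟩ := (toHomotopyCat 𝒜).map_surjective f₁
    obtain ⟨f₂, rfl⟩ := (toHomotopyCat 𝒜).map_surjective f₂
    obtain ⟨P, t, ht, h⟩ := quasiIso_ext f₁ f₂ s hs ((Quotient.functor_map_eq_iff _ _ _).1 h)
    exact ⟨(toHomotopyCat 𝒜).obj P, (toHomotopyCat 𝒜).map t, (quasiIso_map_iff t).2 ht,
      CategoryTheory.Quotient.sound _ h⟩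

variable (𝒜) in
/-- The derived category `D(A)`: the localisation of `H(A)` at the quasi-isomorphisms, with its
canonical `k`-linear structure. -/
abbrev DerivedCat := (quasiIso 𝒜).Localization

variable (𝒜) in
/-- The canonical functor `C(A) ⥤ D(A)`. -/
abbrev toDerived : DGModule 𝒜 ⥤ DerivedCat 𝒜 := toHomotopyCat 𝒜 ⋙ (quasiIso 𝒜).Q

end DGModule

namespace DGAlgebra

variable {k : Type v} {A : Type u} [Field k] [Ring A] [Algebra k A]

/-- `A` as a differential graded right module over itself. -/
@[reducible] def self (𝒜 : DGAlgebra k A) : DGModule 𝒜 where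
  carrier := A
  tower := ⟨fun c a x => by
    change x * (c • a).unop = c • (x * a.unop)
    rw [unop_smul, mul_smul_comm]⟩
  gr := 𝒜.gr
  internal := 𝒜.internal
  smul_mem hx ha := 𝒜.mul_mem hx ha
  d := 𝒜.d
  d_mem := 𝒜.d_mem
  d_d := 𝒜.d_d
  leibniz a hx := 𝒜.leibniz a hx

lemma mul_mem_cocycles (𝒜 : DGAlgebra k A) {i j m : ℤ} (h : i + j = m) {a b : A}
    (ha : a ∈ 𝒜.self.cocycles i) (hb : b ∈ 𝒜.self.cocycles j) :
    a * b ∈ 𝒜.self.cocycles m := by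
  have ha0 : 𝒜.d a = 0 := ha.2
  have hb0 : 𝒜.d b = 0 := hb.2
  refine ⟨h ▸ 𝒜.mul_mem ha.1 hb.1, ?_⟩
  change 𝒜.d (a * b) = 0
  rw [𝒜.leibniz b ha.1, ha0, hb0, zero_mul, mul_zero, smul_zero, add_zero]

/-- The product of two cocycles of `A`, as a cocycle of degree `m = i + j`. -/
def mulCocycles (𝒜 : DGAlgebra k A) {i j m : ℤ} (h : i + j = m) (a : 𝒜.self.cocycles i)
    (b : 𝒜.self.cocycles j) : 𝒜.self.cocycles m :=
  ⟨HMul.hMul (α := A) (β := A) (γ := A) a.1 b.1, 𝒜.mul_mem_cocycles h a.2 b.2⟩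

/-- A finite dimensional model: `A` is finite dimensional over `k`, `A^i = 0` for `i < 0`,
`A^0 = k`, `A^1 = 0`, and `sup A = sup H^* A`. -/
structure IsFiniteDimModel (𝒜 : DGAlgebra k A) : Prop where
  finite : FiniteDimensional k A
  nontrivial : Nontrivial A
  gr_neg : ∀ i : ℤ, i < 0 → 𝒜.gr i = ⊥
  gr_zero : 𝒜.gr 0 = Submodule.span k {1}
  gr_one : 𝒜.gr 1 = ⊥
  sup_eq : 𝒜.self.sup = 𝒜.self.supCohomology

/-- The Gorenstein condition: `A` satisfies Poincaré duality of dimension `d = sup H^* A`, i.e.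
`Σ^d H^* A` and `D H^* A = Hom_k(H^* A, k)` are isomorphic as graded right `H^* A`-modules and as
graded left `H^* A`-modules. In degree `i - d` such an isomorphism is a `k`-linear isomorphism
`H^i A ≃ Hom_k(H^j A, k)` with `i + j = d`. The right actions are given by `x · a = x a` on
`Σ^d H^* A` and `(f · a)(y) = f (a y)` on `D H^* A`; for `a` of degree `l` the left actions are
given by `a · x = (-1)^(l d) a x` on `Σ^d H^* A` and `(a · f)(y) = (-1)^l f (y a)`
on `D H^* A`. -/
structure IsGorenstein (𝒜 : DGAlgebra k A) : Prop where
  right : ∃ θ : ∀ i j : ℤ, i + j = 𝒜.self.supCohomology →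
      (𝒜.self.cohomology i ≃ₗ[k] Module.Dual k (𝒜.self.cohomology j)),
    ∀ (i l j m n : ℤ) (him : i + l = m) (hln : l + j = n)
      (hm : m + j = 𝒜.self.supCohomology) (hn : i + n = 𝒜.self.supCohomology)
      (x : 𝒜.self.cocycles i) (a : 𝒜.self.cocycles l) (y : 𝒜.self.cocycles j),
      θ m j hm (𝒜.self.cls m (𝒜.mulCocycles him x a)) (𝒜.self.cls j y) =
        θ i n hn (𝒜.self.cls i x) (𝒜.self.cls n (𝒜.mulCocycles hln a y))
  left : ∃ θ : ∀ i j : ℤ, i + j = 𝒜.self.supCohomology →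
      (𝒜.self.cohomology i ≃ₗ[k] Module.Dual k (𝒜.self.cohomology j)),
    ∀ (i l j m n : ℤ) (him : l + i = m) (hln : j + l = n)
      (hm : m + j = 𝒜.self.supCohomology) (hn : i + n = 𝒜.self.supCohomology)
      (x : 𝒜.self.cocycles i) (a : 𝒜.self.cocycles l) (y : 𝒜.self.cocycles j),
      ((l * 𝒜.self.supCohomology).negOnePow : ℤ) •
          θ m j hm (𝒜.self.cls m (𝒜.mulCocycles him a x)) (𝒜.self.cls j y) =
        (l.negOnePow : ℤ) •
          θ i n hn (𝒜.self.cls i x) (𝒜.self.cls n (𝒜.mulCocycles hln y a))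

end DGAlgebra

namespace DGModule

variable {k : Type v} {A : Type u} [Field k] [Ring A] [Algebra k A] {𝒜 : DGAlgebra k A}

/-- The `A`-linear map `A → M`, `a ↦ z · a`. -/
def orbitMap (M : DGModule 𝒜) (z : M) : A →ₗ[Aᵐᵒᵖ] M where
  toFun a := op a • z
  map_add' a b := by rw [MulOpposite.op_add, add_smul]
  map_smul' b a := by
    change op (a * b.unop) • z = b • (op a • z)
    rw [MulOpposite.op_mul, MulOpposite.op_unop, mul_smul]

/-- The morphism `Σ^{-m} A ⟶ M`, `1 ↦ ζ`, given by a cocycle `ζ` of degree `m`. -/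
def ofCocycle (M : DGModule 𝒜) {m : ℤ} (ζ : M.cocycles m) : 𝒜.self.shift (-m) ⟶ M :=
  Hom.ofLin (M := 𝒜.self.shift (-m)) (M.orbitMap (ζ : M))
    (fun i a ha => by
      have h := M.smul_mem ζ.2.1 (show a ∈ 𝒜.gr (i + -m) from ha)
      rwa [add_comm i, add_neg_cancel_left] at h)
    (fun a => by
      have h0 : M.d (ζ : M) = 0 := ζ.2.2
      have h := M.leibniz (n := m) (show A from a) ζ.2.1
      rw [h0, smul_zero, zero_add] at h
      refine Eq.trans ?_ h.symm
      change M.orbitMap (ζ : M) (((-m).negOnePow : ℤ) • 𝒜.d (show A from a)) = _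
      rw [map_zsmul, Int.negOnePow_neg]
      rfl)

/-- The mapping cone of `Σ^{-m} A ⟶ M`, `1 ↦ ζ`. -/
def attach (M : DGModule 𝒜) {m : ℤ} (ζ : M.cocycles m) : DGModule 𝒜 := cone (M.ofCocycle ζ)

/-- The canonical morphism from `M` to the mapping cone of `Σ^{-m} A ⟶ M`, `1 ↦ ζ`. -/
def toAttach (M : DGModule 𝒜) {m : ℤ} (ζ : M.cocycles m) : M ⟶ M.attach ζ :=
  coneInr (M.ofCocycle ζ)

/-- The endomorphism algebra of a differential graded module in the derived category. -/
abbrev EndD (M : DGModule 𝒜) := End ((toDerived 𝒜).obj M)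

end DGModule

/-- The two kinds of construction steps. -/
inductive StepKind
  | first
  | second

/-- The degree `e_n` of a construction step starting at `C_{n-1}`: it is `sup C_{n-1}` for a step of
the first kind and `sup C_{n-1} - d + e` with `d = sup A` for a step of the second kind. -/
def stepDegree {k : Type v} {A : Type u} [Field k] [Ring A] [Algebra k A] {𝒜 : DGAlgebra k A}
    (e : ℤ) (C : DGModule 𝒜) : StepKind → ℤ
  | .first => C.sup
  | .second => C.sup - 𝒜.self.sup + e

/-- The number `e_n^A = e_n - (sup C_{n-1} - d)`, for a construction step starting at `C_{n-1}`. -/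
def stepDegreeA {k : Type v} {A : Type u} [Field k] [Ring A] [Algebra k A] {𝒜 : DGAlgebra k A}
    (e : ℤ) (C : DGModule 𝒜) (κ : StepKind) : ℤ :=
  stepDegree e C κ - (C.sup - 𝒜.self.sup)

/-- A step of the first kind is always allowed. A step of the second kind requires
`2 ≤ e ≤ d - 2` and `H^e A ≠ 0`, and must not follow directly a step of the second kind. -/
def StepAllowed {k : Type v} {A : Type u} [Field k] [Ring A] [Algebra k A] (𝒜 : DGAlgebra k A)
    (e : ℤ) (last : Option StepKind) : StepKind → Prop
  | .first => True
  | .second => 2 ≤ e ∧ e ≤ 𝒜.self.sup - 2 ∧ Nontrivial (𝒜.self.cohomology e) ∧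
      last ≠ some .second

/-- `Constructible 𝒜 e n last C` says that `C` is an object `C_n` obtained from `C_0 = A` by `n`
construction steps of the first and second kind, where `last` is the kind of the last step (`none`
if `n = 0`). A step replaces `C` by the mapping cone of a morphism `Σ^{-m} A ⟶ C`, `1 ↦ ζ`, where
`m` is the degree of the step and `ζ` is a cocycle of degree `m` with non-zero class in `H^m C`. -/
inductive Constructible {k : Type v} {A : Type u} [Field k] [Ring A] [Algebra k A]
    (𝒜 : DGAlgebra k A) (e : ℤ) : ℕ → Option StepKind → DGModule 𝒜 → Prop
  | zero : Constructible 𝒜 e 0 none 𝒜.self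
  | step {n : ℕ} {last : Option StepKind} {C : DGModule 𝒜} (hC : Constructible 𝒜 e n last C)
      (κ : StepKind) (hκ : StepAllowed 𝒜 e last κ) (ζ : C.cocycles (stepDegree e C κ))
      (hζ : C.cls _ ζ ≠ 0) : Constructible 𝒜 e (n + 1) (some κ) (C.attach ζ)

/-- An object of a preadditive category is indecomposable if it is non-zero and if in every
decomposition as a direct sum of two objects one of them is zero. -/
def IsIndecomposable {C : Type*} [Category C] [Preadditive C] (X : C) : Prop :=
  ¬ Limits.IsZero X ∧ ∀ (Y Z : C) (b : Limits.BinaryBicone Y Z), Nonempty b.IsBilimit →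
    Nonempty (X ≅ b.pt) → Limits.IsZero Y ∨ Limits.IsZero Z

end

/-!
The objects `C` obtained by construction steps are semifree: as graded modules they are direct sums
of `A` and of one shifted copy of `A` for each step. Hence they are homotopically projective, and morphisms
out of them in the derived category are morphisms of differential graded modules up to homotopy
(`IsHProjective.toDerived_map_surjective`, `IsHProjective.toDerived_map_eq_iff`).

Everything else follows from degree reasons. The generators of `C` are ordered by degree, the last
one has degree `t = sup C - d` and is the only one in this degree, and `A` vanishes in negative
degrees with `A^0 = k`. So there is no homogeneous map `C → A` of degree less than `-t`, and those
of degree `-t` are the multiples of the projection `p` to the last copy of `A`. This applies in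
particular to the endomorphisms of a mapping cone, which are triangular matrices
`(x, y) ↦ (c x, θ x + b y)` with `c` in `k`, `b` an endomorphism of `C` and `d θ = b ζ - c ζ`. Also,
`p` is an isomorphism in cohomology in the degrees relevant for the next step; in the lowest of these
degrees this uses that a nonzero class of `A` can be multiplied into the top class, which is Poincaré
duality. These properties are collected in `IsTopCell` and pass to mapping cones by
`IsTopCell.attach`.

Since `p` is injective on cohomology in the degree of `ζ` and `b` acts on the last copy of `A` by a
scalar, every `b` extends to the mapping cone, so that restriction `ρ` is a surjection from the
endomorphisms of the cone to those of `C`. Its kernel consists of the matrices given by cocycles `θ`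
of degree `m - 1`, where `m = t + e` is the degree of `ζ`, up to coboundaries, and so is the
cohomology of `A` in degree `e - 1` by means of `p` (`IsTopCell.exists_cohomology_equiv_ker`). The
scalar `c` is an augmentation of the endomorphism algebra, and by induction its kernel has square
zero. An algebra of this form is local, and every linear section of `ρ` that respects unit and
augmentation is multiplicative, so that the extension is trivial (`exists_algEquiv_trivSqZeroExt`).
-/

noncomputable section

/-! ### Algebras that are square zero extensions of the base field -/

/-- If the kernel of an augmentation `ε : R → k` has square zero, then `R` is local. -/
lemma IsLocalRing.of_augmentation_sq_zero {k R : Type*} [Field k] [Ring R] [Algebra k R]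
    (ε : R →ₐ[k] k) (h : ∀ x y, ε x = 0 → ε y = 0 → x * y = 0) : IsLocalRing R := by
  have hu : ∀ a : R, ε a ≠ 0 → IsUnit a := by
    intro a ha
    have h0 : ε (1 - (ε a)⁻¹ • a) = 0 := by simp [ha]
    have hn : IsNilpotent (1 - (ε a)⁻¹ • a) := ⟨2, by rw [sq]; exact h _ _ h0 h0⟩
    have h1 : IsUnit ((ε a)⁻¹ • a) := by simpa using hn.isUnit_one_sub
    have h2 : a = algebraMap k R (ε a) * ((ε a)⁻¹ • a) := by
      rw [← Algebra.smul_def, smul_smul, mul_inv_cancel₀ ha, one_smul]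
    rw [h2]
    exact ((Ne.isUnit ha).map (algebraMap k R)).mul h1
  have : Nontrivial R := ε.toRingHom.domain_nontrivial
  refine IsLocalRing.of_is_unit_or_is_unit_of_add_one fun {a b} hab => ?_
  by_cases ha : ε a = 0
  · refine Or.inr (hu b fun hb => ?_)
    have := congrArg ε hab
    rw [map_add, ha, hb, map_one, add_zero] at this
    exact zero_ne_one this
  · exact Or.inl (hu a ha)

/-- A surjection `ρ : R' → R` over which the product of `R'` is controlled by an augmentation
`ε : R → k`, in the sense that two elements of `R'` whose images have augmentation zero multiply to
zero, is a trivial extension of `R` by its kernel: every `k`-linear section that respects the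
augmentation and the unit is multiplicative. Both actions of `R` on the kernel are through `ε`. -/
lemma exists_algEquiv_trivSqZeroExt {k R R' M : Type*} [Field k] [Ring R] [Algebra k R]
    [Ring R'] [Algebra k R'] [AddCommGroup M] [Module k M] (ρ : R' →ₐ[k] R)
    (hρ : Function.Surjective ρ) (ε : R →ₐ[k] k)
    (h : ∀ x y, ε (ρ x) = 0 → ε (ρ y) = 0 → x * y = 0)
    (ψ : M ≃ₗ[k] LinearMap.ker ρ.toLinearMap) :
    ∃ (_ : Module R M) (_ : Module Rᵐᵒᵖ M) (_ : SMulCommClass R Rᵐᵒᵖ M)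
      (_ : IsScalarTower k R M) (_ : IsScalarTower k Rᵐᵒᵖ M)
      (Φ : R' ≃ₐ[k] TrivSqZeroExt R M), ∀ a, (Φ a).fst = ρ a := by
  let εop : Rᵐᵒᵖ →+* k := ε.toRingHom.fromOpposite fun _ _ => mul_comm _ _
  let i1 : Module R M := Module.compHom M ε.toRingHom
  let i2 : Module Rᵐᵒᵖ M := Module.compHom M εop
  have hl : ∀ (r : R) (m : M), r • m = ε r • m := fun _ _ => rfl
  have hr : ∀ (r : R) (m : M), op r • m = ε r • m := fun _ _ => rfl
  have hr' : ∀ (r : Rᵐᵒᵖ) (m : M), r • m = ε r.unop • m := fun _ _ => rfl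
  have i3 : SMulCommClass R Rᵐᵒᵖ M := ⟨fun r s m => by
    rw [hl, hr', hr', hl, smul_comm]⟩
  have i4 : IsScalarTower k R M := ⟨fun c r m => by
    rw [hl, hl, map_smul, smul_assoc]⟩
  have i5 : IsScalarTower k Rᵐᵒᵖ M := ⟨fun c r m => by
    rw [hr', hr', unop_smul, map_smul, smul_assoc]⟩
  obtain ⟨s, hs⟩ := ρ.toLinearMap.exists_rightInverse_of_surjective (LinearMap.range_eq_top.2 hρ)
  have hs' : ∀ r, ρ (s r) = r := fun r => LinearMap.congr_fun hs r
  -- the section, corrected so that it preserves the unit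
  let σ : R →ₗ[k] R' := s + (ε.toLinearMap.smulRight (1 - s 1))
  have hσ : ∀ r, σ r = s r + ε r • (1 - s 1) := fun _ => rfl
  have hρσ : ∀ r, ρ (σ r) = r := fun r => by
    rw [hσ, map_add, map_smul, map_sub, hs', hs', map_one, sub_self, smul_zero, add_zero]
  have hσ1 : σ 1 = 1 := by rw [hσ, map_one ε, one_smul, add_sub_cancel]
  have hψ : ∀ m, ρ (ψ m : R') = 0 := fun m => (ψ m).2
  have hρΨ : ∀ r m, ρ (σ r + ψ m) = r := fun r m => by rw [map_add, hρσ, hψ, add_zero]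
  -- the product of `R'` in terms of the augmentation
  have hmul : ∀ x y : R', x * y = ε (ρ x) • y + ε (ρ y) • x - (ε (ρ x) * ε (ρ y)) • 1 := by
    intro x y
    have := h (x - ε (ρ x) • 1) (y - ε (ρ y) • 1) (by simp) (by simp)
    rw [sub_mul, mul_sub, mul_sub, mul_smul_comm, smul_mul_assoc, smul_mul_assoc, mul_smul_comm,
      mul_one, one_mul, mul_one, smul_smul] at this
    rw [← sub_eq_zero, ← this]
    abel
  have hmulR : ∀ x y : R, x * y = ε x • y + ε y • x - (ε x * ε y) • 1 := by
    intro x y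
    have := congrArg ρ (hmul (σ x) (σ y))
    simpa only [map_mul, map_add, map_sub, map_smul, map_one, hρσ] using this
  let Ψl : TrivSqZeroExt R M →ₗ[k] R' :=
    σ.coprod ((LinearMap.ker ρ.toLinearMap).subtype ∘ₗ ψ.toLinearMap)
  have hΨl : ∀ x, Ψl x = σ x.fst + ψ x.snd := fun _ => rfl
  let Ψ : TrivSqZeroExt R M →ₐ[k] R' := AlgHom.ofLinearMap Ψl
    (by rw [hΨl, TrivSqZeroExt.fst_one, TrivSqZeroExt.snd_one, map_zero, hσ1]; simp)
    (fun x y => by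
      rw [hmul, hΨl, hΨl, hΨl, hρΨ, hρΨ, TrivSqZeroExt.fst_mul,
        TrivSqZeroExt.snd_mul, hmulR, hl, hr]
      simp only [map_add, map_sub, map_smul, hσ1, Submodule.coe_add, Submodule.coe_smul, smul_add]
      abel)
  have hΨ : ∀ x, Ψ x = σ x.fst + ψ x.snd := fun _ => rfl
  have hbij : Function.Bijective Ψ := by
    constructor
    · rw [injective_iff_map_eq_zero]
      intro x hx
      have h1 : x.fst = 0 := by
        have := congrArg ρ hx
        rwa [hΨ, hρΨ, map_zero] at this
      have h2 : ψ x.snd = 0 := by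
        rw [hΨ, h1, map_zero, zero_add] at hx
        exact Subtype.ext hx
      exact TrivSqZeroExt.ext h1 (ψ.map_eq_zero_iff.1 h2)
    · intro a
      have ha : a - σ (ρ a) ∈ LinearMap.ker ρ.toLinearMap := by
        change ρ (a - σ (ρ a)) = 0
        rw [map_sub, hρσ, sub_self]
      refine ⟨TrivSqZeroExt.inl (ρ a) + TrivSqZeroExt.inr (ψ.symm ⟨_, ha⟩), ?_⟩
      rw [hΨ]
      simp
  refine ⟨i1, i2, i3, i4, i5, (AlgEquiv.ofBijective Ψ hbij).symm, fun a => ?_⟩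
  obtain ⟨x, rfl⟩ := hbij.2 a
  have : (AlgEquiv.ofBijective Ψ hbij).symm (Ψ x) = x :=
    (AlgEquiv.ofBijective Ψ hbij).symm_apply_apply x
  rw [this, hΨ, hρΨ]

/-- An object whose endomorphism ring is local is indecomposable: a local ring has no idempotents
other than `0` and `1`. -/
lemma IsIndecomposable.of_isLocalRing_end {C : Type*} [Category C] [Preadditive C] {X : C}
    (h : IsLocalRing (End X)) : IsIndecomposable X := by
  refine ⟨fun hX => one_ne_zero (α := End X) (hX.eq_of_src _ _), ?_⟩
  rintro Y Z b ⟨hb⟩ ⟨e⟩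
  have key : ∀ {W : C} (i : W ⟶ X) (q : X ⟶ W), i ≫ q = 𝟙 W →
      IsUnit (1 - End.of (q ≫ i)) → Limits.IsZero W := by
    intro W i q hiq hu
    have h0 : (1 - End.of (q ≫ i)) * End.of (q ≫ i) = 0 := by
      rw [sub_mul, one_mul, sub_eq_zero]
      change q ≫ i = (q ≫ i) ≫ (q ≫ i)
      rw [Category.assoc, reassoc_of% hiq]
    have h1 : q ≫ i = 0 := hu.mul_right_eq_zero.1 h0
    rw [Limits.IsZero.iff_id_eq_zero, ← Category.comp_id (𝟙 W), ← hiq, Category.assoc,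
      reassoc_of% h1]
    simp
  have htot : b.fst ≫ b.inl + b.snd ≫ b.inr = 𝟙 b.pt := Limits.IsBilimit.binary_total hb
  have hsum : End.of ((e.hom ≫ b.fst) ≫ (b.inl ≫ e.inv)) +
      End.of ((e.hom ≫ b.snd) ≫ (b.inr ≫ e.inv)) = 1 := by
    change (e.hom ≫ b.fst) ≫ (b.inl ≫ e.inv) + (e.hom ≫ b.snd) ≫ (b.inr ≫ e.inv) = 𝟙 X
    have := congrArg (fun z => e.hom ≫ z ≫ e.inv) htot
    simpa [Preadditive.add_comp, Preadditive.comp_add] using this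
  rcases IsLocalRing.isUnit_or_isUnit_of_add_one hsum with hu | hu
  · refine Or.inr (key (b.inr ≫ e.inv) (e.hom ≫ b.snd) (by simp) ?_)
    rwa [← eq_sub_of_add_eq hsum]
  · refine Or.inl (key (b.inl ≫ e.inv) (e.hom ≫ b.fst) (by simp) ?_)
    rwa [← eq_sub_of_add_eq' hsum]

/-! ### Poincaré duality for the algebra -/

namespace DGAlgebra

variable {k : Type v} {A : Type u} [Field k] [Ring A] [Algebra k A] {𝒜 : DGAlgebra k A}

namespace IsFiniteDimModel

lemma finite_gr_ne_bot (hA : 𝒜.IsFiniteDimModel) : {i : ℤ | 𝒜.self.gr i ≠ ⊥}.Finite := by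
  have := hA.finite
  exact WellFoundedGT.finite_ne_bot_of_iSupIndep 𝒜.internal.submodule_iSupIndep

lemma one_ne_zero (hA : 𝒜.IsFiniteDimModel) : (1 : A) ≠ 0 := by
  have := hA.nontrivial
  exact _root_.one_ne_zero

lemma gr_sup_ne_bot (hA : 𝒜.IsFiniteDimModel) : 𝒜.gr 𝒜.self.sup ≠ ⊥ := by
  have h0 : (0 : ℤ) ∈ {i : ℤ | 𝒜.self.gr i ≠ ⊥} := fun h => hA.one_ne_zero <| by
    have := 𝒜.one_mem
    rwa [show 𝒜.gr 0 = ⊥ from h, Submodule.mem_bot] at this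
  exact Int.csSup_mem ⟨0, h0⟩ hA.finite_gr_ne_bot.bddAbove

lemma gr_eq_bot_of_sup_lt (hA : 𝒜.IsFiniteDimModel) {i : ℤ} (hi : 𝒜.self.sup < i) :
    𝒜.gr i = ⊥ := by
  by_contra h
  exact hi.not_ge (le_csSup hA.finite_gr_ne_bot.bddAbove h)

lemma eq_zero_of_neg (hA : 𝒜.IsFiniteDimModel) {i : ℤ} (hi : i < 0) {a : A}
    (ha : a ∈ 𝒜.gr i) : a = 0 := by
  rwa [hA.gr_neg i hi, Submodule.mem_bot] at ha

lemma exists_smul_one (hA : 𝒜.IsFiniteDimModel) {a : A} (ha : a ∈ 𝒜.gr 0) :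
    ∃ c : k, a = c • (1 : A) := by
  rw [hA.gr_zero, Submodule.mem_span_singleton] at ha
  exact ha.imp fun _ h => h.symm

lemma d_one (hA : 𝒜.IsFiniteDimModel) : 𝒜.d 1 = 0 := by
  have := 𝒜.d_mem 𝒜.one_mem
  rwa [zero_add, hA.gr_one, Submodule.mem_bot] at this

lemma one_mem_cocycles (hA : 𝒜.IsFiniteDimModel) : (1 : A) ∈ 𝒜.self.cocycles 0 :=
  ⟨𝒜.one_mem, hA.d_one⟩

lemma exists_cls_zero_eq (hA : 𝒜.IsFiniteDimModel) (x : 𝒜.self.cohomology 0) :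
    ∃ c : k, x = c • 𝒜.self.cls 0 ⟨1, hA.one_mem_cocycles⟩ := by
  obtain ⟨x, rfl⟩ := DGModule.cls_surjective 0 x
  obtain ⟨c, hc⟩ := hA.exists_smul_one x.2.1
  exact ⟨c, by rw [← map_smul]; exact congrArg _ (Subtype.ext hc)⟩

/-- Apart from degree zero, cohomology can only live in degrees at least two, so that there is none
if the supremum is less than two. -/
lemma two_le_sup (hA : 𝒜.IsFiniteDimModel)
    (hdim : 2 ≤ Module.rank k (DirectSum ℤ fun i => 𝒜.self.cohomology i)) :
    2 ≤ 𝒜.self.sup := by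
  by_contra! hlt
  have hbot : ∀ i : ℤ, i ≠ 0 → 𝒜.gr i = ⊥ := by
    intro i hi
    rcases lt_trichotomy i 0 with h | h | h
    · exact hA.gr_neg i h
    · exact absurd h hi
    · rcases (show 1 ≤ i by omega).eq_or_lt with rfl | h1
      · exact hA.gr_one
      · exact hA.gr_eq_bot_of_sup_lt (by omega)
  have hzero : ∀ i : ℤ, i ≠ 0 → ∀ x : 𝒜.self.cohomology i, x = 0 := by
    intro i hi x
    obtain ⟨x, rfl⟩ := DGModule.cls_surjective i x
    have h1 : (x : A) ∈ 𝒜.gr i := x.2.1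
    rw [hbot i hi, Submodule.mem_bot] at h1
    rw [show x = 0 from Subtype.ext h1, map_zero]
  have hle : Module.rank k (DirectSum ℤ fun i => 𝒜.self.cohomology i) ≤ 1 := by
    refine (rank_le_one_iff (K := k) (V := DirectSum ℤ fun i => 𝒜.self.cohomology i)).2
      ⟨DirectSum.of _ 0 (𝒜.self.cls 0 ⟨1, hA.one_mem_cocycles⟩), fun x => ?_⟩
    obtain ⟨c, hc⟩ := hA.exists_cls_zero_eq (x 0)
    refine ⟨c, DFinsupp.ext fun i => ?_⟩
    by_cases hi : i = 0
    · subst hi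
      rw [hc]
      exact congrArg (fun z : 𝒜.self.cohomology 0 => c • z) (DirectSum.of_eq_same _ _)
    · rw [hzero i hi (x i)]
      exact hzero i hi _
  exact absurd (hdim.trans hle) (by norm_num)

/-- Poincaré duality: a nonzero class of degree `i` can be multiplied into every class of the top
degree. -/
lemma exists_mul_eq_add_d (hA : 𝒜.IsFiniteDimModel) (hG : 𝒜.IsGorenstein) {i j : ℤ}
    (hij : i + j = 𝒜.self.sup) {x y : A} (hx : x ∈ 𝒜.self.cocycles i)
    (hx0 : x ∉ 𝒜.self.coboundaries i) (hy : y ∈ 𝒜.self.cocycles 𝒜.self.sup) :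
    ∃ u ∈ 𝒜.self.cocycles j, ∃ w ∈ 𝒜.gr (𝒜.self.sup - 1), y = x * u + 𝒜.d w := by
  obtain ⟨θ, hθ⟩ := hG.right
  rw [hA.sup_eq] at hij hy ⊢
  have h0 : 𝒜.self.cls i ⟨x, hx⟩ ≠ 0 := fun h => hx0 ((DGModule.cls_eq_zero_iff _).1 h)
  have h1 : θ i j hij (𝒜.self.cls i ⟨x, hx⟩) ≠ 0 := (θ i j hij).map_ne_zero_iff.2 h0
  obtain ⟨a, ha⟩ := DFunLike.ne_iff.1 h1
  obtain ⟨a, rfl⟩ := DGModule.cls_surjective j a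
  rw [LinearMap.zero_apply] at ha
  let one : 𝒜.self.cocycles 0 := ⟨1, hA.one_mem_cocycles⟩
  let v := 𝒜.mulCocycles hij ⟨x, hx⟩ a
  have hv := hθ i j 0 _ j hij (add_zero j) (add_zero _) hij ⟨x, hx⟩ a one
  rw [show 𝒜.mulCocycles (add_zero j) a one = a from Subtype.ext (mul_one (a : A))] at hv
  have hv0 : θ _ 0 (add_zero _) (𝒜.self.cls _ v) (𝒜.self.cls 0 one) ≠ 0 := hv.trans_ne ha
  let c : k := θ _ 0 (add_zero _) (𝒜.self.cls _ ⟨y, hy⟩) (𝒜.self.cls 0 one) /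
    θ _ 0 (add_zero _) (𝒜.self.cls _ v) (𝒜.self.cls 0 one)
  -- the functionals on `H^0 A = k` given by `y` and by a multiple of `x a` agree
  have hc : 𝒜.self.cls _ ⟨y, hy⟩ = c • 𝒜.self.cls _ v := by
    refine (θ _ 0 (add_zero _)).injective (LinearMap.ext fun z => ?_)
    obtain ⟨b, rfl⟩ := hA.exists_cls_zero_eq z
    rw [map_smul, map_smul, map_smul, LinearMap.smul_apply]
    congr 1
    rw [smul_eq_mul]
    exact (div_mul_cancel₀ _ hv0).symm
  rw [← sub_eq_zero, ← map_smul, ← map_sub, DGModule.cls_eq_zero_iff] at hc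
  obtain ⟨w, hw, hwy⟩ := hc
  refine ⟨c • (a : A), Submodule.smul_mem _ c a.2, w, hw, ?_⟩
  have hwy' : 𝒜.d w = y - c • (x * (a : A)) := hwy
  rw [hwy', mul_smul_comm, add_sub_cancel]

end IsFiniteDimModel

end DGAlgebra

namespace DGModule

variable {k : Type v} {A : Type u} [Field k] [Ring A] [Algebra k A] {𝒜 : DGAlgebra k A}

/-! ### Homogeneous maps -/

/-- An `A`-linear map of degree `j`. -/
def IsHomogeneous {M N : DGModule 𝒜} (f : M →ₗ[Aᵐᵒᵖ] N) (j : ℤ) : Prop :=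
  ∀ ⦃i i' : ℤ⦄, i' = i + j → ∀ x ∈ M.gr i, f x ∈ N.gr i'

lemma isHomogeneous_lin {M N : DGModule 𝒜} (f : M ⟶ N) : IsHomogeneous (lin f) 0 := by
  rintro i i' rfl x hx
  rw [add_zero]
  exact Hom.map_mem f hx

lemma IsHomogeneous.comp {M N P : DGModule 𝒜} {f : M →ₗ[Aᵐᵒᵖ] N} {g : N →ₗ[Aᵐᵒᵖ] P} {i j l : ℤ}
    (hg : IsHomogeneous g j) (hf : IsHomogeneous f i) (h : l = i + j) :
    IsHomogeneous (g ∘ₗ f) l :=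
  fun a b hb x hx => hg (show b = a + i + j by omega) _ (hf rfl x hx)

lemma homotopic_iff {M N : DGModule 𝒜} (f g : M ⟶ N) : Homotopic f g ↔
    ∃ h : M →ₗ[Aᵐᵒᵖ] N, IsHomogeneous h (-1) ∧
      ∀ x, lin f x - lin g x = N.d (h x) + h (M.d x) := by
  refine exists_congr fun h => and_congr_left fun _ => ⟨?_, fun hh i x hx => hh rfl x hx⟩
  rintro hh i i' rfl x hx
  exact hh i x hx

lemma homotopic_zero_iff {M N : DGModule 𝒜} (f : M ⟶ N) : Homotopic f 0 ↔
    ∃ h : M →ₗ[Aᵐᵒᵖ] N, IsHomogeneous h (-1) ∧ ∀ x, lin f x = N.d (h x) + h (M.d x) := by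
  rw [homotopic_iff]
  have : ∀ x, lin (0 : M ⟶ N) x = 0 := fun _ => rfl
  simp only [this, sub_zero]

lemma homotopic_iff_sub {M N : DGModule 𝒜} (f g : M ⟶ N) :
    Homotopic f g ↔ Homotopic (f - g) 0 := by
  rw [homotopic_iff, homotopic_zero_iff]
  rfl

lemma d_smul_of_mem_cocycles {M : DGModule 𝒜} {i : ℤ} {x : M} (hx : x ∈ M.cocycles i) (a : A) :
    M.d (op a • x) = (i.negOnePow : ℤ) • (op (𝒜.d a) • x) := by
  have h0 : M.d x = 0 := hx.2
  rw [M.leibniz a hx.1, h0, smul_zero, zero_add]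

/-- Maps out of `A` are determined by the image of `1`. -/
lemma apply_eq_smul_one {M : DGModule 𝒜} (f : 𝒜.self →ₗ[Aᵐᵒᵖ] M) (a : A) :
    f a = op a • f (1 : A) := by
  rw [← map_smul]
  congr 1
  exact (one_mul a).symm

/-! ### The structure of the mapping cone of a cocycle -/

section Attach

variable {C : DGModule 𝒜} {m : ℤ} (ζ : C.cocycles m)

/-- The inclusion of `A` into the graded module underlying the mapping cone. -/
def attachInl : 𝒜.self →ₗ[Aᵐᵒᵖ] C.attach ζ := LinearMap.inl Aᵐᵒᵖ 𝒜.self C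

/-- The projection of the mapping cone to `A`. -/
def attachFst : C.attach ζ →ₗ[Aᵐᵒᵖ] 𝒜.self := LinearMap.fst Aᵐᵒᵖ 𝒜.self C

/-- The projection of the graded module underlying the mapping cone to `C`. -/
def attachSnd : C.attach ζ →ₗ[Aᵐᵒᵖ] C := LinearMap.snd Aᵐᵒᵖ 𝒜.self C

/-- The inclusion of `C` into the mapping cone. -/
abbrev attachInr : C →ₗ[Aᵐᵒᵖ] C.attach ζ := lin (C.toAttach ζ)

lemma attach_eq (x : C.attach ζ) :
    x = attachInl ζ (attachFst ζ x) + attachInr ζ (attachSnd ζ x) :=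
  (Prod.fst_add_snd x).symm

@[simp] lemma attachFst_inl (a : 𝒜.self) : attachFst ζ (attachInl ζ a) = a := rfl
@[simp] lemma attachSnd_inl (a : 𝒜.self) : attachSnd ζ (attachInl ζ a) = 0 := rfl
@[simp] lemma attachFst_inr (y : C) : attachFst ζ (attachInr ζ y) = 0 := rfl
@[simp] lemma attachSnd_inr (y : C) : attachSnd ζ (attachInr ζ y) = y := rfl

lemma attachFst_d (x : C.attach ζ) : attachFst ζ ((C.attach ζ).d x) =
    ((m - 1).negOnePow : ℤ) • 𝒜.d (attachFst ζ x) := by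
  change -(((-m).negOnePow : ℤ) • 𝒜.d (attachFst ζ x)) = _
  rw [Int.negOnePow_neg, Int.negOnePow_sub, Int.negOnePow_one, mul_neg, mul_one, Units.val_neg,
    neg_smul]

lemma attachSnd_d (x : C.attach ζ) : attachSnd ζ ((C.attach ζ).d x) =
    op (attachFst ζ x : A) • (ζ : C) + C.d (attachSnd ζ x) := rfl

lemma attach_d_inl (a : 𝒜.self) : (C.attach ζ).d (attachInl ζ a) =
    attachInl ζ (((m - 1).negOnePow : ℤ) • 𝒜.d a) + attachInr ζ (op (a : A) • (ζ : C)) := by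
  rw [attach_eq ζ ((C.attach ζ).d (attachInl ζ a)), attachFst_d, attachSnd_d, attachSnd_inl,
    map_zero, add_zero, attachFst_inl]

lemma attach_d_inr (y : C) : (C.attach ζ).d (attachInr ζ y) = attachInr ζ (C.d y) :=
  (Hom.comm (C.toAttach ζ) y).symm

lemma mem_attach_gr {i j : ℤ} (h : j = i + 1 - m) {x : C.attach ζ} :
    x ∈ (C.attach ζ).gr i ↔ attachFst ζ x ∈ 𝒜.gr j ∧ attachSnd ζ x ∈ C.gr i := by
  subst h
  rfl

lemma isHomogeneous_attachFst : IsHomogeneous (attachFst ζ) (1 - m) :=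
  fun i i' h x hx => ((mem_attach_gr ζ (show i' = i + 1 - m by omega)).1 hx).1

lemma isHomogeneous_attachSnd : IsHomogeneous (attachSnd ζ) 0 :=
  fun i i' h x hx => by
    rw [add_zero] at h
    subst h
    exact ((mem_attach_gr ζ rfl).1 hx).2

lemma isHomogeneous_attachInl : IsHomogeneous (attachInl ζ) (m - 1) :=
  fun i i' h x hx => (mem_attach_gr ζ (show i = i' + 1 - m by omega)).2
    ⟨hx, Submodule.zero_mem _⟩

lemma isHomogeneous_attachInr : IsHomogeneous (attachInr ζ) 0 := isHomogeneous_lin _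

lemma attachInr_mem_coboundaries {i : ℤ} {y : C} (hy : y ∈ C.coboundaries i) :
    attachInr ζ y ∈ (C.attach ζ).coboundaries i :=
  map_coboundaries _ i hy

lemma attach_apply_inl {N : DGModule 𝒜} (f : C.attach ζ →ₗ[Aᵐᵒᵖ] N) (a : A) :
    f (attachInl ζ a) = op a • f (attachInl ζ (1 : A)) :=
  apply_eq_smul_one (f ∘ₗ attachInl ζ) a

lemma attach_apply {N : DGModule 𝒜} (f : C.attach ζ →ₗ[Aᵐᵒᵖ] N) (x : C.attach ζ) :
    f x = op (attachFst ζ x : A) • f (attachInl ζ (1 : A)) + f (attachInr ζ (attachSnd ζ x)) := by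
  rw [← attach_apply_inl, ← map_add, ← attach_eq]

/-- A null-homotopy on the mapping cone consists of a null-homotopy `g` on `C` and of an element `w`
that bounds the obstruction to extending it. -/
lemma attach_homotopic_zero {N : DGModule 𝒜} (f : C.attach ζ ⟶ N) (g : C →ₗ[Aᵐᵒᵖ] N)
    (hg : IsHomogeneous g (-1)) (hf : ∀ y, lin f (attachInr ζ y) = N.d (g y) + g (C.d y))
    {w : N} (hw : w ∈ N.gr (m - 2)) (h1 : N.d w = lin f (attachInl ζ (1 : A)) - g ζ) :
    Homotopic f 0 := by
  rw [homotopic_zero_iff]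
  refine ⟨N.orbitMap w ∘ₗ attachFst ζ + g ∘ₗ attachSnd ζ, ?_, fun x => ?_⟩
  · rintro i i' rfl x hx
    rw [mem_attach_gr ζ rfl] at hx
    refine Submodule.add_mem _ ?_ (hg rfl _ hx.2)
    have := N.smul_mem hw hx.1
    rwa [show m - 2 + (i + 1 - m) = i + -1 by omega] at this
  · have hs : (m - 2).negOnePow = -(m - 1).negOnePow := by
      rw [show m - 1 = m - 2 + 1 by omega, Int.negOnePow_succ, neg_neg]
    have e : ∀ z, (N.orbitMap w ∘ₗ attachFst ζ + g ∘ₗ attachSnd ζ) z =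
        op (attachFst ζ z : A) • w + g (attachSnd ζ z) := fun _ => rfl
    rw [e, e, attachFst_d, attachSnd_d, attach_apply, hf]
    generalize attachFst ζ x = a
    generalize attachSnd ζ x = y
    rw [map_add, map_add, N.leibniz a hw, h1, hs, map_smul, smul_sub, op_smul, smul_assoc,
      Units.val_neg, neg_smul]
    abel

end Attach

/-! ### Homotopically projective modules -/

/-- A differential graded module is homotopically projective if all morphisms to acyclic modules
are null-homotopic. -/
def IsHProjective (C : DGModule 𝒜) : Prop :=
  ∀ (N : DGModule 𝒜), Acyclic N → ∀ f : C ⟶ N, Homotopic f 0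

lemma isHProjective_self (hA : 𝒜.IsFiniteDimModel) : IsHProjective 𝒜.self := by
  intro N hN f
  have h1 : lin f (1 : A) ∈ N.cocycles 0 := map_cocycles f 0 hA.one_mem_cocycles
  obtain ⟨w, hw, hd⟩ := hN 0 h1
  rw [homotopic_zero_iff]
  refine ⟨N.orbitMap w, ?_, fun x => ?_⟩
  · rintro i i' rfl x hx
    have := N.smul_mem hw hx
    rwa [show (0 : ℤ) - 1 + i = i + -1 by omega] at this
  · change lin f x = N.d (op (x : A) • w) + op (𝒜.d x) • w
    rw [N.leibniz _ hw, hd, ← apply_eq_smul_one]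
    simp

lemma IsHProjective.attach {C : DGModule 𝒜} (hC : IsHProjective C)
    (hA : 𝒜.IsFiniteDimModel) {m : ℤ} (ζ : C.cocycles m) : IsHProjective (C.attach ζ) := by
  intro N hN f
  obtain ⟨g, hg, hgf⟩ := (homotopic_zero_iff _).1 (hC N hN (C.toAttach ζ ≫ f))
  have hgf' : ∀ y, lin f (attachInr ζ y) = N.d (g y) + g (C.d y) := hgf
  have hζ0 : C.d ζ = 0 := ζ.2.2
  have hc : lin f (attachInl ζ (1 : A)) - g ζ ∈ N.cocycles (m - 1) := by
    refine ⟨Submodule.sub_mem _ ?_ (hg (by omega) _ ζ.2.1), ?_⟩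
    · exact Hom.map_mem f (isHomogeneous_attachInl ζ (by omega) (1 : A) 𝒜.one_mem)
    · change N.d (_ - _) = 0
      rw [map_sub, ← Hom.comm f, attach_d_inl, hA.d_one, smul_zero, map_zero, zero_add,
        op_one, one_smul, hgf', hζ0, map_zero, add_zero, sub_self]
  obtain ⟨w, hw, hd⟩ := hN _ hc
  rw [show m - 1 - 1 = m - 2 by omega] at hw
  exact attach_homotopic_zero ζ f g hg hgf' hw hd

/-- Morphisms from a homotopically projective module lift along quasi-isomorphisms. -/
lemma IsHProjective.exists_lift {C X P : DGModule 𝒜} (hC : IsHProjective C) (s : X ⟶ P)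
    (hs : IsQuasiIso s) (f : C ⟶ P) : ∃ f' : C ⟶ X, Homotopic (f' ≫ s) f := by
  obtain ⟨h, hh, hd⟩ := (homotopic_zero_iff _).1 (hC _ (acyclic_cone hs) (f ≫ coneInr s))
  have hd1 : ∀ x, (0 : X) = -X.d (h x).1 + (h (C.d x)).1 := fun x => congrArg Prod.fst (hd x)
  have hd2 : ∀ x, lin f x = lin s (h x).1 + P.d (h x).2 + (h (C.d x)).2 :=
    fun x => congrArg Prod.snd (hd x)
  refine ⟨Hom.ofLin (LinearMap.fst Aᵐᵒᵖ X P ∘ₗ h) (fun i x hx => ?_) (fun x => ?_), ?_⟩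
  · have := (hh (show i - 1 = i + -1 from rfl) x hx).1
    rwa [sub_add_cancel] at this
  · change (h (C.d x)).1 = X.d (h x).1
    rw [← sub_eq_zero, sub_eq_neg_add, ← hd1]
  · rw [homotopic_iff]
    refine ⟨-(LinearMap.snd Aᵐᵒᵖ X P ∘ₗ h),
      fun i i' hi x hx => Submodule.neg_mem _ (hh hi x hx).2, fun x => ?_⟩
    change lin s (h x).1 - lin f x = P.d (-(h x).2) + -(h (C.d x)).2
    rw [hd2, map_neg]
    abel

lemma IsHProjective.homotopic_of_comp {C X P : DGModule 𝒜} (hC : IsHProjective C) (s : X ⟶ P)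
    (hs : IsQuasiIso s) (f : C ⟶ X) (hf : Homotopic (f ≫ s) 0) : Homotopic f 0 := by
  obtain ⟨h, hh, hd⟩ := (homotopic_zero_iff _).1 hf
  have hd' : ∀ x, lin s (lin f x) = P.d (h x) + h (C.d x) := hd
  let K : DGModule 𝒜 := (cone s).shift (-1)
  have hK : Acyclic K := (acyclic_cone hs).shift (-1)
  have hKd : ∀ p : X × P, K.d p = ((X.d p.1, -lin s p.1 - P.d p.2) : X × P) := by
    intro p
    change (((-1 : ℤ).negOnePow : ℤˣ) : ℤ) • ((-X.d p.1, lin s p.1 + P.d p.2) : X × P) = _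
    ext
    · simp
    · simp; abel
  -- `f` together with the null-homotopy of `f ≫ s` is a morphism to the homotopy fibre of `s`
  let q : C ⟶ K := Hom.ofLin ((lin f).prod (-h))
    (fun i x hx => by
      refine ⟨?_, Submodule.neg_mem _ (hh rfl x hx)⟩
      change lin f x ∈ X.gr (i + -1 + 1)
      rw [neg_add_cancel_right]
      exact Hom.map_mem f hx)
    (fun x => by
      refine Eq.trans ?_ (hKd (lin f x, -h x)).symm
      refine Prod.ext (Hom.comm f x) ?_
      change -h (C.d x) = -lin s (lin f x) - P.d (-h x)
      rw [hd', map_neg]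
      abel)
  obtain ⟨g, hg, hgd⟩ := (homotopic_zero_iff _).1 (hC K hK q)
  rw [homotopic_zero_iff]
  refine ⟨LinearMap.fst Aᵐᵒᵖ X P ∘ₗ g, fun i i' hi x hx => ?_, fun x => ?_⟩
  · have h1 : (g x).1 ∈ X.gr (i' + -1 + 1) := (hg hi x hx).1
    rwa [neg_add_cancel_right] at h1
  · have h1 : ((lin f x, -h x) : X × P) = K.d (g x) + g (C.d x) := hgd x
    rw [hKd] at h1
    exact congrArg Prod.fst h1

/-- Morphisms in the derived category out of a homotopically projective module are represented by
morphisms of differential graded modules. -/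
lemma IsHProjective.toDerived_map_surjective {C : DGModule 𝒜} (hC : IsHProjective C)
    {X : DGModule 𝒜} (f : (toDerived 𝒜).obj C ⟶ (toDerived 𝒜).obj X) :
    ∃ g : C ⟶ X, (toDerived 𝒜).map g = f := by
  obtain ⟨φ, hφ⟩ := Localization.exists_leftFraction (quasiIso 𝒜).Q (quasiIso 𝒜) f
  obtain ⟨s, hs, hsq⟩ := φ.hs
  obtain ⟨g, hg⟩ := (toHomotopyCat 𝒜).map_surjective φ.f
  obtain ⟨g', hg'⟩ := hC.exists_lift s hsq g
  refine ⟨g', ?_⟩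
  have h1 : (toHomotopyCat 𝒜).map g' ≫ φ.s = φ.f := by
    rw [← hs, ← hg, ← Functor.map_comp]
    exact CategoryTheory.Quotient.sound _ hg'
  have h2 := φ.map_comp_map_s (quasiIso 𝒜).Q (Localization.inverts _ _)
  have : IsIso ((quasiIso 𝒜).Q.map φ.s) := Localization.inverts _ (quasiIso 𝒜) _ φ.hs
  rw [← cancel_mono ((quasiIso 𝒜).Q.map φ.s), hφ, h2, ← h1, Functor.map_comp]
  rfl

lemma toDerived_map_eq_of_homotopic {C X : DGModule 𝒜} {f g : C ⟶ X} (h : Homotopic f g) :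
    (toDerived 𝒜).map f = (toDerived 𝒜).map g :=
  congrArg (quasiIso 𝒜).Q.map (CategoryTheory.Quotient.sound _ h)

lemma IsHProjective.toDerived_map_eq_zero_iff {C : DGModule 𝒜} (hC : IsHProjective C)
    {X : DGModule 𝒜} (f : C ⟶ X) : (toDerived 𝒜).map f = 0 ↔ Homotopic f 0 := by
  refine ⟨fun h => ?_, fun h => ?_⟩
  · rw [← (toDerived 𝒜).map_zero C X] at h
    obtain ⟨Z, s, ⟨s, rfl, hs⟩, hf⟩ :=
      (MorphismProperty.map_eq_iff_postcomp (quasiIso 𝒜).Q (quasiIso 𝒜) _ _).1 h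
    refine hC.homotopic_of_comp s hs f ?_
    rw [← Functor.map_comp, ← Functor.map_comp] at hf
    have := (Quotient.functor_map_eq_iff _ _ _).1 hf
    rwa [Limits.zero_comp] at this
  · rw [toDerived_map_eq_of_homotopic h, Functor.map_zero]

lemma IsHProjective.toDerived_map_eq_iff {C : DGModule 𝒜} (hC : IsHProjective C)
    {X : DGModule 𝒜} (f g : C ⟶ X) :
    (toDerived 𝒜).map f = (toDerived 𝒜).map g ↔ Homotopic f g := by
  rw [homotopic_iff_sub, ← hC.toDerived_map_eq_zero_iff, Functor.map_sub, sub_eq_zero]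

/-! ### Endomorphisms of a mapping cone as triangular matrices -/

section Attach

variable {C : DGModule 𝒜} {m : ℤ} (ζ : C.cocycles m)

lemma attach_ext {x y : C.attach ζ} (h1 : attachFst ζ x = attachFst ζ y)
    (h2 : attachSnd ζ x = attachSnd ζ y) : x = y :=
  Prod.ext h1 h2

/-- The endomorphism `(a, y) ↦ (c a, θ a + b y)` of the mapping cone. -/
def attachEnd (b : C ⟶ C) (c : k) {θ : C} (hθ : θ ∈ C.gr (m - 1))
    (hd : C.d θ = lin b (ζ : C) - c • (ζ : C)) : C.attach ζ ⟶ C.attach ζ :=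
  Hom.ofLin (c • (attachInl ζ ∘ₗ attachFst ζ) +
      attachInr ζ ∘ₗ (C.orbitMap θ ∘ₗ attachFst ζ + lin b ∘ₗ attachSnd ζ))
    (fun i x hx => by
      have hx' := (mem_attach_gr ζ rfl).1 hx
      refine Submodule.add_mem _ (Submodule.smul_mem _ c ?_) ?_
      · exact isHomogeneous_attachInl ζ (by omega) _ hx'.1
      · refine Hom.map_mem (C.toAttach ζ) (Submodule.add_mem _ ?_ (Hom.map_mem b hx'.2))
        have := C.smul_mem hθ hx'.1
        rwa [show m - 1 + (i + 1 - m) = i by omega] at this)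
    (fun x => by
      have e : ∀ z, (c • (attachInl ζ ∘ₗ attachFst ζ) +
          attachInr ζ ∘ₗ (C.orbitMap θ ∘ₗ attachFst ζ + lin b ∘ₗ attachSnd ζ)) z =
          c • attachInl ζ (attachFst ζ z) +
            attachInr ζ (op (attachFst ζ z : A) • θ + lin b (attachSnd ζ z)) := fun _ => rfl
      have e1 : ∀ (a : 𝒜.self) (y : C),
          attachFst ζ (c • attachInl ζ a + attachInr ζ y) = c • a :=
        fun a y => add_zero (c • a)
      have e2 : ∀ (a : 𝒜.self) (y : C),
          attachSnd ζ (c • attachInl ζ a + attachInr ζ y) = y :=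
        fun a y => show c • (0 : C) + y = y by rw [smul_zero, zero_add]
      rw [e, e]
      refine attach_ext ζ ?_ ?_
      · rw [e1, attachFst_d, attachFst_d, e1]
        change _ = _ • 𝒜.d (c • _)
        rw [map_smul, smul_comm]
      · rw [e2, attachSnd_d, attachSnd_d, e1, e2, attachFst_d]
        generalize attachFst ζ x = a
        generalize attachSnd ζ x = y
        rw [map_add, map_add, C.leibniz a hθ, hd, map_smul, smul_sub, op_smul, smul_assoc,
          Hom.comm b]
        rw [op_smul, smul_assoc, smul_comm _ c]
        abel)

variable (b : C ⟶ C) (c : k) {θ : C} (hθ : θ ∈ C.gr (m - 1))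
  (hd : C.d θ = lin b (ζ : C) - c • (ζ : C))

lemma attachEnd_apply (x : C.attach ζ) : lin (attachEnd ζ b c hθ hd) x =
    c • attachInl ζ (attachFst ζ x) +
      attachInr ζ (op (attachFst ζ x : A) • θ + lin b (attachSnd ζ x)) := rfl

lemma attachFst_attachEnd (x : C.attach ζ) :
    attachFst ζ (lin (attachEnd ζ b c hθ hd) x) = c • attachFst ζ x :=
  add_zero (c • attachFst ζ x)

lemma attachSnd_attachEnd (x : C.attach ζ) : attachSnd ζ (lin (attachEnd ζ b c hθ hd) x) =
    op (attachFst ζ x : A) • θ + lin b (attachSnd ζ x) := by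
  change c • (0 : C) + (op (attachFst ζ x : A) • θ + lin b (attachSnd ζ x)) = _
  rw [smul_zero, zero_add]

lemma toAttach_attachEnd :
    C.toAttach ζ ≫ attachEnd ζ b c hθ hd = b ≫ C.toAttach ζ :=
  hom_ext fun y => attach_ext ζ
    ((attachFst_attachEnd ζ b c hθ hd (attachInr ζ y)).trans (smul_zero c))
    ((attachSnd_attachEnd ζ b c hθ hd (attachInr ζ y)).trans (by
      rw [attachFst_inr, attachSnd_inr]
      change (op (0 : A)) • θ + lin b y = lin b y
      rw [op_zero, zero_smul, zero_add]))

/-- The off-diagonal entry of an endomorphism of the mapping cone. -/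
lemma exists_d_eq_of_attach_end (hA : 𝒜.IsFiniteDimModel) {a : C.attach ζ ⟶ C.attach ζ}
    {b : C ⟶ C} {c : k} (hab : C.toAttach ζ ≫ a = b ≫ C.toAttach ζ)
    (hc : ∀ x, attachFst ζ (lin a x) = c • attachFst ζ x) :
    ∃ θ ∈ C.gr (m - 1), attachSnd ζ (lin a (attachInl ζ (1 : A))) = θ ∧
      C.d θ = lin b (ζ : C) - c • (ζ : C) := by
  have h1 : attachInl ζ (1 : A) ∈ (C.attach ζ).gr (m - 1) :=
    isHomogeneous_attachInl ζ (by omega) (1 : A) 𝒜.one_mem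
  refine ⟨_, isHomogeneous_attachSnd ζ (add_zero _).symm _ (Hom.map_mem a h1), rfl, ?_⟩
  have h2 := congrArg (attachSnd ζ) (Hom.comm a (attachInl ζ (1 : A)))
  have h3 : lin a (attachInr ζ ζ) = attachInr ζ (lin b (ζ : C)) :=
    LinearMap.congr_fun (congrArg Hom.lin hab) (ζ : C)
  have h4 : op (c • (1 : A)) • (ζ : C) = c • (ζ : C) := by
    rw [op_smul, smul_assoc, op_one, one_smul]
  rw [attach_d_inl, hA.d_one, smul_zero, map_zero, zero_add, op_one, one_smul] at h2
  erw [h3] at h2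
  rw [attachSnd_inr, attachSnd_d] at h2
  erw [hc] at h2
  rw [attachFst_inl] at h2
  rw [h2]
  erw [h4]
  rw [add_sub_cancel_left]

end Attach

/-! ### The projection to the last copy of the algebra -/

/-- `C` is built from shifted copies of `A`, of which the last one is generated in degree `t`, and
`p` is the projection to this copy, a morphism of degree `-t`. It detects the cohomology of `C` from
degree `t + r` on. -/
structure IsTopCell (C : DGModule 𝒜) (p : C →ₗ[Aᵐᵒᵖ] 𝒜.self) (t r : ℤ) : Prop where
  isHomogeneous : IsHomogeneous p (-t)
  map_d : ∀ x, p (C.d x) = (t.negOnePow : ℤ) • 𝒜.d (p x)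
  exists_gen : ∃ u ∈ C.gr t, p u = (1 : A)
  gr_eq_bot : ∀ i, t + 𝒜.self.sup < i → C.gr i = ⊥
  /-- all generators of `C` have degree at most `t`, and `A` vanishes in negative degrees -/
  eq_zero_of_lt : ∀ (f : C →ₗ[Aᵐᵒᵖ] 𝒜.self) (j : ℤ), j < -t → IsHomogeneous f j → f = 0
  /-- the last generator is the only one of degree `t` -/
  exists_smul : ∀ f : C →ₗ[Aᵐᵒᵖ] 𝒜.self, IsHomogeneous f (-t) → ∃ c : k, ∀ x, f x = c • p x
  mem_coboundaries : ∀ i j, j = t + i → r ≤ i → ∀ x ∈ C.cocycles j,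
    p x ∈ 𝒜.self.coboundaries i → x ∈ C.coboundaries j
  exists_cocycle : ∀ i j, j = t + i → r ≤ i → ∀ y ∈ 𝒜.self.cocycles i,
    ∃ x ∈ C.cocycles j, p x = y
  /-- the endomorphisms that vanish on the last copy of `A` form an ideal of square zero -/
  comp_homotopic_zero : ∀ a b : C ⟶ C, (∀ x, p (lin a x) = 0) → (∀ x, p (lin b x) = 0) →
    Homotopic (a ≫ b) 0
  isHProjective : IsHProjective C

lemma isTopCell_self (hA : 𝒜.IsFiniteDimModel) (r : ℤ) :
    IsTopCell 𝒜.self LinearMap.id 0 r where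
  isHomogeneous i i' h x hx := by
    rw [neg_zero, add_zero] at h
    subst h
    exact hx
  map_d x := by simp
  exists_gen := ⟨(1 : A), 𝒜.one_mem, rfl⟩
  gr_eq_bot i hi := hA.gr_eq_bot_of_sup_lt (by omega)
  eq_zero_of_lt f j hj hf := by
    refine LinearMap.ext fun x => ?_
    rw [apply_eq_smul_one, show f (1 : A) = 0 from
      hA.eq_zero_of_neg (show (0 : ℤ) + j < 0 by omega) (hf rfl (1 : A) 𝒜.one_mem), smul_zero]
    rfl
  exists_smul f hf := by
    obtain ⟨c, hc⟩ := hA.exists_smul_one (hf (i' := 0) (by omega) (1 : A) 𝒜.one_mem)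
    refine ⟨c, fun x => ?_⟩
    rw [apply_eq_smul_one, hc]
    change c • (1 : A) * (x : A) = c • (x : A)
    rw [smul_mul_assoc, one_mul]
  mem_coboundaries i j hj _ x _ h := by
    rw [zero_add] at hj
    subst hj
    exact h
  exists_cocycle i j hj _ y hy := by
    rw [zero_add] at hj
    subst hj
    exact ⟨y, hy, rfl⟩
  comp_homotopic_zero a b ha hb := by
    have : a ≫ b = 0 := hom_ext fun x => hb _
    rw [this]
    exact (homotopic_iff _ _).2 ⟨0, fun _ _ _ _ _ => Submodule.zero_mem _, by simp⟩
  isHProjective := isHProjective_self hA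

namespace IsTopCell

variable {C : DGModule 𝒜} {p : C →ₗ[Aᵐᵒᵖ] 𝒜.self} {t r : ℤ}

lemma sup_eq (h : IsTopCell C p t r) (hA : 𝒜.IsFiniteDimModel) : C.sup = t + 𝒜.self.sup := by
  refine IsGreatest.csSup_eq ⟨fun h0 => ?_, fun i hi => ?_⟩
  · obtain ⟨u, hu, hu1⟩ := h.exists_gen
    refine hA.gr_sup_ne_bot ((Submodule.eq_bot_iff _).2 fun y hy => ?_)
    have h1 := C.smul_mem hu hy
    rw [h0, Submodule.mem_bot] at h1
    have h2 := congrArg p h1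
    rw [map_smul, hu1, map_zero] at h2
    rw [← h2]
    exact (one_mul y).symm
  · by_contra hlt
    exact hi (h.gr_eq_bot i (not_le.1 hlt))

lemma eq_zero_of_lt_apply (h : IsTopCell C p t r) {f : C →ₗ[Aᵐᵒᵖ] 𝒜.self} {j : ℤ} (hj : j < -t)
    (hf : IsHomogeneous f j) (x : C) : f x = 0 :=
  LinearMap.congr_fun (h.eq_zero_of_lt f j hj hf) x

lemma map_mem_cocycles (h : IsTopCell C p t r) {i j : ℤ} (hj : j = t + i) {x : C}
    (hx : x ∈ C.cocycles j) : p x ∈ 𝒜.self.cocycles i := by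
  have h0 : C.d x = 0 := hx.2
  refine ⟨h.isHomogeneous (by omega) x hx.1, ?_⟩
  have h1 := h.map_d x
  rw [h0, map_zero] at h1
  change 𝒜.d (p x) = 0
  have hu : ((t.negOnePow : ℤˣ) : ℤ) * ((t.negOnePow : ℤˣ) : ℤ) = 1 := by
    rw [← Units.val_mul, Int.units_mul_self, Units.val_one]
  rw [← one_smul ℤ (𝒜.d (p x)), ← hu, mul_smul, ← h1, smul_zero]

lemma map_mem_coboundaries (h : IsTopCell C p t r) {i j : ℤ} (hj : j = t + i) {x : C}
    (hx : x ∈ C.coboundaries j) : p x ∈ 𝒜.self.coboundaries i := by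
  obtain ⟨w, hw, rfl⟩ := hx
  rw [h.map_d]
  exact zsmul_mem (Submodule.mem_map_of_mem
    (h.isHomogeneous (show i - 1 = j - 1 + -t by omega) w hw)) _

/-- An endomorphism of `C` acts on the last copy of `A` by a scalar. -/
lemma exists_scalar (h : IsTopCell C p t r) (b : C ⟶ C) : ∃ c : k, ∀ x, p (lin b x) = c • p x :=
  h.exists_smul (p ∘ₗ lin b) (h.isHomogeneous.comp (isHomogeneous_lin b) (by omega))

/-- The scalar by which an endomorphism acts on the last copy of `A` is a homotopy invariant. -/
lemma map_eq_of_homotopic (h : IsTopCell C p t r) {b b' : C ⟶ C} (hb : Homotopic b b') (x : C) :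
    p (lin b x) = p (lin b' x) := by
  obtain ⟨g, hg, hgd⟩ := (homotopic_iff _ _).1 hb
  have h0 := h.eq_zero_of_lt_apply (show -t - 1 < -t by omega)
    (h.isHomogeneous.comp hg (by omega))
  have h0' : ∀ y, p (g y) = 0 := h0
  rw [← sub_eq_zero, ← map_sub, hgd, map_add, h.map_d, h0', h0', map_zero, smul_zero, add_zero]

section Attach

variable {m e : ℤ} (ζ : C.cocycles m)

lemma attachFst_apply_eq_zero (h : IsTopCell C p t r) (hm : m = t + e) (he : 2 ≤ e)
    {f : C →ₗ[Aᵐᵒᵖ] C.attach ζ} {j : ℤ} (hj : j ≤ 0) (hf : IsHomogeneous f j) (x : C) :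
    attachFst ζ (f x) = 0 :=
  h.eq_zero_of_lt_apply (show 1 - m + j < -t by omega)
    ((isHomogeneous_attachFst ζ).comp hf (by omega)) x

/-- Every endomorphism of the mapping cone restricts to `C`. -/
lemma exists_restrict (h : IsTopCell C p t r) (hm : m = t + e) (he : 2 ≤ e)
    (a : C.attach ζ ⟶ C.attach ζ) :
    ∃ b : C ⟶ C, C.toAttach ζ ≫ a = b ≫ C.toAttach ζ := by
  have h0 := h.attachFst_apply_eq_zero ζ hm he le_rfl (isHomogeneous_lin (C.toAttach ζ ≫ a))
  refine ⟨Hom.ofLin (attachSnd ζ ∘ₗ lin (C.toAttach ζ ≫ a)) (fun i x hx => ?_) (fun x => ?_),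
    hom_ext fun x => attach_ext ζ (h0 x) rfl⟩
  · exact isHomogeneous_attachSnd ζ (add_zero i).symm _ (Hom.map_mem (C.toAttach ζ ≫ a) hx)
  · change attachSnd ζ (lin (C.toAttach ζ ≫ a) (C.d x)) = _
    rw [Hom.comm (C.toAttach ζ ≫ a), attachSnd_d]
    erw [h0 x]
    change (op (0 : A)) • (ζ : C) + _ = _
    rw [op_zero, zero_smul, zero_add]
    rfl

/-- An endomorphism of `C` is determined up to homotopy by its composition with the inclusion into
the mapping cone. -/
lemma homotopic_zero_of_comp_toAttach (h : IsTopCell C p t r) (hm : m = t + e) (he : 2 ≤ e)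
    {b : C ⟶ C} (hb : Homotopic (b ≫ C.toAttach ζ) 0) : Homotopic b 0 := by
  obtain ⟨g, hg, hgd⟩ := (homotopic_zero_iff _).1 hb
  rw [homotopic_zero_iff]
  refine ⟨attachSnd ζ ∘ₗ g, (isHomogeneous_attachSnd ζ).comp hg (by omega), fun x => ?_⟩
  have h1 := congrArg (attachSnd ζ) (hgd x)
  rw [map_add, attachSnd_d, h.attachFst_apply_eq_zero ζ hm he (by omega) hg] at h1
  refine Eq.trans h1 ?_
  change (op (0 : A)) • (ζ : C) + _ + _ = _
  rw [op_zero, zero_smul, zero_add]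
  rfl

lemma map_notMem_coboundaries (h : IsTopCell C p t r) (hm : m = t + e) (hr : r ≤ e)
    (hζ : (ζ : C) ∉ C.coboundaries m) : p ζ ∉ 𝒜.self.coboundaries e :=
  fun h0 => hζ (h.mem_coboundaries e m hm hr _ ζ.2 h0)

/-- Every endomorphism of `C` extends to the mapping cone, acting by the same scalar on the last
copies of `A`. -/
lemma exists_extend (h : IsTopCell C p t r) (hm : m = t + e) (hr : r ≤ e) {b : C ⟶ C} {c : k}
    (hb : ∀ x, p (lin b x) = c • p x) :
    ∃ a : C.attach ζ ⟶ C.attach ζ, C.toAttach ζ ≫ a = b ≫ C.toAttach ζ ∧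
      ∀ x, attachFst ζ (lin a x) = c • attachFst ζ x := by
  have h1 : lin b (ζ : C) - c • (ζ : C) ∈ C.coboundaries m := by
    refine h.mem_coboundaries e m hm hr _
      (Submodule.sub_mem _ (map_cocycles b m ζ.2) (Submodule.smul_mem _ c ζ.2)) ?_
    rw [map_sub, hb, p.map_smul_of_tower, sub_self]
    exact Submodule.zero_mem _
  obtain ⟨θ, hθ, hd⟩ := h1
  exact ⟨attachEnd ζ b c hθ hd, toAttach_attachEnd ζ b c hθ hd, attachFst_attachEnd ζ b c hθ hd⟩

/-- An endomorphism of the mapping cone and its restriction to `C` act by the same scalar on the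
last copies of `A`, since the class of `ζ` is not zero. -/
lemma scalar_eq_of_attach_end (h : IsTopCell C p t r) (hA : 𝒜.IsFiniteDimModel) (hm : m = t + e)
    (hr : r ≤ e) (hζ : (ζ : C) ∉ C.coboundaries m) {a : C.attach ζ ⟶ C.attach ζ} {b : C ⟶ C}
    {c : k} (hab : C.toAttach ζ ≫ a = b ≫ C.toAttach ζ)
    (hc : ∀ x, attachFst ζ (lin a x) = c • attachFst ζ x) (x : C) : p (lin b x) = c • p x := by
  obtain ⟨c', hc'⟩ := h.exists_scalar b
  obtain ⟨θ, hθ, -, hd⟩ := exists_d_eq_of_attach_end ζ hA hab hc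
  have h1 : (c' - c) • p ζ ∈ 𝒜.self.coboundaries e := by
    rw [sub_smul, ← hc', ← p.map_smul_of_tower c, ← map_sub, ← hd]
    exact h.map_mem_coboundaries hm ⟨θ, hθ, rfl⟩
  rw [hc']
  congr 1
  by_contra hne
  exact h.map_notMem_coboundaries ζ hm hr hζ
    ((Submodule.smul_mem_iff _ (sub_ne_zero.2 hne)).1 h1)

/-- The mapping cone of a nonzero class in a degree where the cohomology of `C` is that of the last
copy of `A`. The new projection detects cohomology from the top degree of `C` on: in that degree
this uses that the top class of `C` is a multiple of `ζ`, by Poincaré duality. -/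
lemma attach (h : IsTopCell C p t r) (hA : 𝒜.IsFiniteDimModel) (hG : 𝒜.IsGorenstein)
    (hm : m = t + e) (he : 2 ≤ e) (hr : r ≤ e - 1) (hed : e ≤ 𝒜.self.sup)
    (hζ : (ζ : C) ∉ C.coboundaries m) :
    IsTopCell (C.attach ζ) (attachFst ζ) (m - 1) (𝒜.self.sup + 1 - e) where
  isHomogeneous := by
    rw [neg_sub]
    exact isHomogeneous_attachFst ζ
  map_d := attachFst_d ζ
  exists_gen := ⟨attachInl ζ (1 : A), isHomogeneous_attachInl ζ (by omega) (1 : A) 𝒜.one_mem, rfl⟩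
  gr_eq_bot i hi := by
    refine (Submodule.eq_bot_iff _).2 fun x hx => ?_
    rw [mem_attach_gr ζ rfl, hA.gr_eq_bot_of_sup_lt (by omega), h.gr_eq_bot i (by omega)] at hx
    exact attach_ext ζ hx.1 hx.2
  eq_zero_of_lt f j hj hf := by
    refine LinearMap.ext fun x => ?_
    have h1 : f (attachInl ζ (1 : A)) = 0 :=
      hA.eq_zero_of_neg (show (0 : ℤ) + (m - 1 + j) < 0 by omega)
        (hf.comp (isHomogeneous_attachInl ζ) rfl rfl (1 : A) 𝒜.one_mem)
    have h2 := h.eq_zero_of_lt_apply (show j < -t by omega)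
      (hf.comp (isHomogeneous_attachInr ζ) (zero_add j).symm) (attachSnd ζ x)
    rw [attach_apply, h1, smul_zero, zero_add]
    exact h2
  exists_smul f hf := by
    obtain ⟨c, hc⟩ := hA.exists_smul_one
      (hf.comp (isHomogeneous_attachInl ζ) rfl (i' := 0) (by omega) (1 : A) 𝒜.one_mem)
    refine ⟨c, fun x => ?_⟩
    have h2 : f (attachInr ζ (attachSnd ζ x)) = 0 :=
      h.eq_zero_of_lt_apply (show -(m - 1) < -t by omega)
        (hf.comp (isHomogeneous_attachInr ζ) (zero_add _).symm) (attachSnd ζ x)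
    have h1 : f (attachInl ζ (1 : A)) = c • (1 : A) := hc
    rw [attach_apply, h1, h2, add_zero]
    change c • (1 : A) * (attachFst ζ x : A) = c • (attachFst ζ x : A)
    rw [smul_mul_assoc, one_mul]
  mem_coboundaries i j hj hi x hx hpx := by
    have hu : (((m - 1).negOnePow : ℤˣ) : ℤ) * (((m - 1).negOnePow : ℤˣ) : ℤ) = 1 := by
      rw [← Units.val_mul, Int.units_mul_self, Units.val_one]
    -- it suffices to treat cocycles of `C`
    suffices key : ∀ y ∈ C.cocycles j, attachInr ζ y ∈ (C.attach ζ).coboundaries j by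
      obtain ⟨w, hw, hwx⟩ := hpx
      have hw' : attachInl ζ (((m - 1).negOnePow : ℤ) • w) ∈ (C.attach ζ).gr (j - 1) :=
        isHomogeneous_attachInl ζ (by omega) _ (zsmul_mem hw _)
      have hdw : 𝒜.d w = attachFst ζ x := hwx
      have hx0 : (C.attach ζ).d x = 0 := hx.2
      have h1 : attachFst ζ (x - (C.attach ζ).d
          (attachInl ζ (((m - 1).negOnePow : ℤ) • w))) = 0 := by
        rw [map_sub, attachFst_d, attachFst_inl, map_zsmul, hdw, smul_smul, hu, one_smul, sub_self]
      have h2 : x - (C.attach ζ).d (attachInl ζ (((m - 1).negOnePow : ℤ) • w)) ∈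
          (C.attach ζ).cocycles j := by
        refine Submodule.sub_mem _ hx ⟨?_, (C.attach ζ).d_d _⟩
        have := (C.attach ζ).d_mem hw'
        rwa [sub_add_cancel] at this
      generalize hz : x - (C.attach ζ).d (attachInl ζ (((m - 1).negOnePow : ℤ) • w)) = z at h1 h2
      have h3 : z = attachInr ζ (attachSnd ζ z) := by
        conv_lhs => rw [attach_eq ζ z, h1, map_zero, zero_add]
      have h4 : attachSnd ζ z ∈ C.cocycles j := by
        refine ⟨isHomogeneous_attachSnd ζ (add_zero j).symm _ h2.1, ?_⟩
        have h5 : (C.attach ζ).d z = 0 := h2.2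
        rw [h3, attach_d_inr] at h5
        exact congrArg (attachSnd ζ) h5
      have h5 := key _ h4
      rw [← h3, ← hz] at h5
      have h6 := Submodule.add_mem _ h5 (Submodule.mem_map_of_mem hw')
      rwa [sub_add_cancel] at h6
    intro y hy
    rcases (show t + 𝒜.self.sup ≤ j by omega).lt_or_eq with hlt | heq
    · have h0 : y = 0 := by
        have : y ∈ C.gr j := hy.1
        rwa [h.gr_eq_bot j hlt, Submodule.mem_bot] at this
      rw [h0, map_zero]
      exact Submodule.zero_mem _
    · obtain ⟨v, hv, w, hw, hvw⟩ := hA.exists_mul_eq_add_d hG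
        (show e + (𝒜.self.sup - e) = 𝒜.self.sup by omega) (h.map_mem_cocycles hm ζ.2)
        (h.map_notMem_coboundaries ζ hm (by omega) hζ) (h.map_mem_cocycles heq.symm hy)
      have h1 : op v • (ζ : C) ∈ C.cocycles j := by
        refine ⟨?_, ?_⟩
        · have := C.smul_mem ζ.2.1 hv.1
          rwa [show m + (𝒜.self.sup - e) = j by omega] at this
        · have hv0 : 𝒜.d v = 0 := hv.2
          change C.d _ = 0
          rw [d_smul_of_mem_cocycles ζ.2, hv0, op_zero, zero_smul, smul_zero]
      have h2 : y - op v • (ζ : C) ∈ C.coboundaries j := by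
        refine h.mem_coboundaries _ j heq.symm (by omega) _ (Submodule.sub_mem _ hy h1) ?_
        refine ⟨w, hw, ?_⟩
        rw [map_sub, map_smul, hvw]
        exact (add_sub_cancel_left _ _).symm
      have hv0 : 𝒜.d v = 0 := hv.2
      have h3 : attachInr ζ (op v • (ζ : C)) ∈ (C.attach ζ).coboundaries j := by
        refine ⟨attachInl ζ v, isHomogeneous_attachInl ζ (by omega) _ hv.1, ?_⟩
        rw [attach_d_inl, hv0, smul_zero, map_zero, zero_add]
      have h4 := Submodule.add_mem _ (attachInr_mem_coboundaries ζ h2) h3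
      rwa [← map_add, sub_add_cancel] at h4
  exists_cocycle i j hj hi y hy := by
    have hy0 : 𝒜.d y = 0 := hy.2
    refine ⟨attachInl ζ y, ⟨isHomogeneous_attachInl ζ (by omega) y hy.1, ?_⟩, rfl⟩
    have h1 : op (y : A) • (ζ : C) = 0 := by
      have := C.smul_mem ζ.2.1 hy.1
      rwa [h.gr_eq_bot _ (by omega), Submodule.mem_bot] at this
    change (C.attach ζ).d _ = 0
    rw [attach_d_inl, hy0, h1, smul_zero, map_zero, map_zero, add_zero]
  comp_homotopic_zero a a' ha ha' := by
    obtain ⟨b, hb⟩ := h.exists_restrict ζ hm he a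
    obtain ⟨b', hb'⟩ := h.exists_restrict ζ hm he a'
    have hc : ∀ x, attachFst ζ (lin a x) = (0 : k) • attachFst ζ x := by simpa using ha
    have hc' : ∀ x, attachFst ζ (lin a' x) = (0 : k) • attachFst ζ x := by simpa using ha'
    have hp := h.scalar_eq_of_attach_end ζ hA hm (by omega) hζ hb hc
    have hp' := h.scalar_eq_of_attach_end ζ hA hm (by omega) hζ hb' hc'
    simp only [zero_smul] at hp hp'
    obtain ⟨θ, hθ, haθ, hdθ⟩ := exists_d_eq_of_attach_end ζ hA hb hc
    rw [zero_smul, sub_zero] at hdθ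
    obtain ⟨g, hg, hgd⟩ := (homotopic_zero_iff _).1 (h.comp_homotopic_zero b b' hp hp')
    have hgd' : ∀ x, lin b' (lin b x) = C.d (g x) + g (C.d x) := hgd
    have hζ0 : C.d ζ = 0 := ζ.2.2
    have hpg : ∀ x, p (g x) = 0 := h.eq_zero_of_lt_apply (show -t - 1 < -t by omega)
      (h.isHomogeneous.comp hg (by omega))
    -- the obstruction to extending the null-homotopy `g` is a cocycle on which `p` vanishes
    have hφ : lin b' θ - g ζ ∈ C.coboundaries (m - 1) := by
      refine h.mem_coboundaries (e - 1) _ (by omega) hr _ ⟨Submodule.sub_mem _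
        (Hom.map_mem b' hθ) (hg (by omega) _ ζ.2.1), ?_⟩ ?_
      · change C.d _ = 0
        rw [map_sub, ← Hom.comm b', hdθ, hgd', hζ0, map_zero, add_zero, sub_self]
      · rw [map_sub, hp', hpg, sub_zero]
        exact Submodule.zero_mem _
    obtain ⟨w, hw, hdw⟩ := hφ
    rw [show m - 1 - 1 = m - 2 by omega] at hw
    have hal : lin a (attachInl ζ (1 : A)) = attachInr ζ θ :=
      attach_ext ζ (ha _) haθ
    have hbr : ∀ y, lin a (attachInr ζ y) = attachInr ζ (lin b y) :=
      fun y => LinearMap.congr_fun (congrArg Hom.lin hb) y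
    have hbr' : ∀ y, lin a' (attachInr ζ y) = attachInr ζ (lin b' y) :=
      fun y => LinearMap.congr_fun (congrArg Hom.lin hb') y
    refine attach_homotopic_zero ζ (a ≫ a') (attachInr ζ ∘ₗ g)
      ((isHomogeneous_attachInr ζ).comp hg (by omega)) (fun y => ?_)
      (w := attachInr ζ w) (Hom.map_mem (C.toAttach ζ) hw) ?_
    · change lin a' (lin a _) = (C.attach ζ).d (attachInr ζ (g y)) + attachInr ζ (g (C.d y))
      rw [hbr, hbr', hgd', attach_d_inr, map_add]
    · change _ = lin a' (lin a _) - attachInr ζ (g ζ)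
      rw [hal, hbr', attach_d_inr, hdw, map_sub]
  isHProjective := h.isHProjective.attach hA ζ

end Attach

end IsTopCell

end DGModule

/-! ### Restriction along a morphism -/

/-- If composition with `ι : X ⟶ Y` is injective on endomorphisms of `X` and every endomorphism of
`Y` restricts to `X`, then restriction is a homomorphism of algebras. -/
lemma CategoryTheory.exists_restrict_algHom {k D : Type*} [Field k] [Category D] [Preadditive D]
    [Linear k D] {X Y : D} (ι : X ⟶ Y) (hι : ∀ b : X ⟶ X, b ≫ ι = 0 → b = 0)
    (h : ∀ a : Y ⟶ Y, ∃ b : X ⟶ X, ι ≫ a = b ≫ ι) :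
    ∃ ρ : End Y →ₐ[k] End X, ∀ a : End Y, ι ≫ a.asHom = (ρ a).asHom ≫ ι := by
  choose ρ hρ using h
  have uniq : ∀ (a : Y ⟶ Y) (b : X ⟶ X), ι ≫ a = b ≫ ι → ρ a = b := fun a b hab => by
    rw [← sub_eq_zero]
    exact hι _ (by rw [Preadditive.sub_comp, ← hρ, hab, sub_self])
  let ρl : End Y →ₗ[k] End X :=
    { toFun := ρ
      map_add' := fun a a' => uniq _ _
        ((Preadditive.comp_add ..).trans ((congrArg₂ (· + ·) (hρ a) (hρ a')).trans
          (Preadditive.add_comp ..).symm))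
      map_smul' := fun c a => uniq _ _
        ((Linear.comp_smul ..).trans ((congrArg (c • ·) (hρ a)).trans
          (Linear.smul_comp ..).symm)) }
  refine ⟨AlgHom.ofLinearMap ρl (uniq _ _ ?_) (fun a a' => uniq _ _ ?_), hρ⟩
  · exact (Category.comp_id ι).trans (Category.id_comp ι).symm
  · change ι ≫ a' ≫ a = (ρ a' ≫ ρ a) ≫ ι
    rw [reassoc_of% (hρ a'), hρ a, Category.assoc]

namespace DGModule

variable {k : Type v} {A : Type u} [Field k] [Ring A] [Algebra k A] {𝒜 : DGAlgebra k A}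

/-! ### The endomorphism algebra in the derived category -/

section AttachCocycle

variable {C : DGModule 𝒜} {m : ℤ} (ζ : C.cocycles m)

/-- The endomorphism `(a, y) ↦ (0, φ a)` of the mapping cone given by a cocycle `φ`. -/
def attachCocycle (φ : C.cocycles (m - 1)) : C.attach ζ ⟶ C.attach ζ :=
  attachEnd ζ 0 0 φ.2.1 (by
    have h0 : C.d (φ : C) = 0 := φ.2.2
    rw [h0, zero_smul, sub_zero]
    rfl)

lemma attachCocycle_apply (φ : C.cocycles (m - 1)) (x : C.attach ζ) :
    lin (attachCocycle ζ φ) x = attachInr ζ (op (attachFst ζ x : A) • (φ : C)) := by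
  refine (attachEnd_apply ζ _ _ _ _ x).trans ?_
  rw [zero_smul, zero_add]
  exact congrArg _ (add_zero _)

/-- `φ ↦ attachCocycle ζ φ`, as a linear map to the derived category. -/
def attachCocycleD : C.cocycles (m - 1) →ₗ[k] (C.attach ζ).EndD where
  toFun φ := End.of ((toDerived 𝒜).map (attachCocycle ζ φ))
  map_add' φ φ' := by
    have : attachCocycle ζ (φ + φ') = attachCocycle ζ φ + attachCocycle ζ φ' :=
      hom_ext fun x => by
        rw [add_lin]
        simp only [attachCocycle_apply, Submodule.coe_add, smul_add, map_add]
    rw [this]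
    exact (toDerived 𝒜).map_add
  map_smul' c φ := by
    have : attachCocycle ζ (c • φ) = c • attachCocycle ζ φ :=
      hom_ext fun x => by
        rw [smul_lin]
        simp only [attachCocycle_apply, Submodule.coe_smul]
        rw [smul_comm, LinearMap.map_smul_of_tower]
    rw [this]
    exact (toDerived 𝒜).map_smul c _

end AttachCocycle

namespace IsTopCell

variable {C : DGModule 𝒜} {p : C →ₗ[Aᵐᵒᵖ] 𝒜.self} {t r : ℤ}

/-- The augmentation of the endomorphism algebra by the action on the last copy of `A`. -/
lemma exists_augmentation (h : IsTopCell C p t r) (hA : 𝒜.IsFiniteDimModel) :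
    ∃ ε : C.EndD →ₐ[k] k, ∀ (b : C ⟶ C) (x : C),
      p (lin b x) = ε (End.of ((toDerived 𝒜).map b)) • p x := by
  obtain ⟨u, -, hu⟩ := h.exists_gen
  have hinj : ∀ c c' : k, c • p u = c' • p u → c = c' := fun c c' hcc => by
    rw [hu] at hcc
    exact smul_left_injective k hA.one_ne_zero hcc
  have h1 : ∀ f : (toDerived 𝒜).obj C ⟶ (toDerived 𝒜).obj C, ∃ c : k, ∃ b : C ⟶ C,
      (toDerived 𝒜).map b = f ∧ ∀ x, p (lin b x) = c • p x := fun f => by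
    obtain ⟨b, hb⟩ := h.isHProjective.toDerived_map_surjective f
    obtain ⟨c, hc⟩ := h.exists_scalar b
    exact ⟨c, b, hb, hc⟩
  choose ε b hb hε using h1
  have uniq : ∀ (b' : C ⟶ C) (c : k), (∀ x, p (lin b' x) = c • p x) →
      ε ((toDerived 𝒜).map b') = c := fun b' c hc => by
    refine hinj _ _ ?_
    rw [← hε, ← hc]
    exact h.map_eq_of_homotopic ((h.isHProjective.toDerived_map_eq_iff _ _).1 (hb _)) u
  have uniq' : ∀ (f : (toDerived 𝒜).obj C ⟶ (toDerived 𝒜).obj C) (b' : C ⟶ C) (c : k),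
      (toDerived 𝒜).map b' = f → (∀ x, p (lin b' x) = c • p x) → ε f = c := by
    rintro _ b' c rfl hc
    exact uniq b' c hc
  let εl : C.EndD →ₗ[k] k :=
    { toFun := ε
      map_add' := fun f g => uniq' _ (b f + b g) _
        ((toDerived 𝒜).map_add.trans (congrArg₂ (· + ·) (hb f) (hb g)))
        fun x => by rw [add_lin, map_add, hε, hε, add_smul]
      map_smul' := fun c f => uniq' _ (c • b f) _
        (((toDerived 𝒜).map_smul c (b f)).trans (congrArg (c • ·) (hb f)))
        fun x => by rw [smul_lin, p.map_smul_of_tower, hε, smul_smul]; rfl }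
  refine ⟨AlgHom.ofLinearMap εl (uniq' _ (𝟙 C) _ ((toDerived 𝒜).map_id C)
    fun x => by rw [one_smul, id_lin]) (fun f g => uniq' _ (b g ≫ b f) _ ?_ fun x => ?_),
    fun b' x => ?_⟩
  · exact ((toDerived 𝒜).map_comp _ _).trans (congrArg₂ (· ≫ ·) (hb g) (hb f))
  · rw [comp_lin, hε, hε, smul_smul]
    rfl
  · obtain ⟨c, hc⟩ := h.exists_scalar b'
    rw [hc]
    exact congrArg (· • p x) (uniq b' c hc).symm

/-- The augmentation ideal of the endomorphism algebra has square zero. -/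
lemma augmentation_mul_eq_zero (h : IsTopCell C p t r) {ε : C.EndD → k}
    (hε : ∀ (b : C ⟶ C) (x : C), p (lin b x) = ε (End.of ((toDerived 𝒜).map b)) • p x)
    (f g : C.EndD) (hf : ε f = 0) (hg : ε g = 0) : f * g = 0 := by
  obtain ⟨a, rfl⟩ := h.isHProjective.toDerived_map_surjective f
  obtain ⟨b, rfl⟩ := h.isHProjective.toDerived_map_surjective g
  have ha : ∀ x, p (lin a x) = 0 := fun x => (hε a x).trans (by
    rw [show ε (End.of ((toDerived 𝒜).map a)) = 0 from hf, zero_smul])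
  have hb : ∀ x, p (lin b x) = 0 := fun x => (hε b x).trans (by
    rw [show ε (End.of ((toDerived 𝒜).map b)) = 0 from hg, zero_smul])
  change (toDerived 𝒜).map b ≫ (toDerived 𝒜).map a = 0
  rw [← Functor.map_comp, h.isHProjective.toDerived_map_eq_zero_iff]
  exact h.comp_homotopic_zero b a hb ha

lemma isLocalRing_endD (h : IsTopCell C p t r) (hA : 𝒜.IsFiniteDimModel) :
    IsLocalRing C.EndD := by
  obtain ⟨ε, hε⟩ := h.exists_augmentation hA
  exact IsLocalRing.of_augmentation_sq_zero ε (h.augmentation_mul_eq_zero hε)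

section Attach

variable {m e : ℤ} (ζ : C.cocycles m)

/-- The endomorphism given by a cocycle `φ` vanishes precisely if `φ` is a coboundary: a
null-homotopy exhibits `φ` as the sum of a coboundary and of `g ζ` for a map `g` of degree `-1`, and
`p ∘ g = 0`. -/
lemma attachCocycleD_eq_zero_iff (h : IsTopCell C p t r) (hA : 𝒜.IsFiniteDimModel)
    (hm : m = t + e) (hr : r ≤ e - 1) (φ : C.cocycles (m - 1)) :
    attachCocycleD ζ φ = 0 ↔ p (φ : C) ∈ 𝒜.self.coboundaries (e - 1) := by
  have hP := h.isHProjective.attach hA ζ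
  refine (hP.toDerived_map_eq_zero_iff (attachCocycle ζ φ)).trans ⟨fun h0 => ?_, fun h0 => ?_⟩
  · obtain ⟨g, hg, hgd⟩ := (homotopic_zero_iff _).1 h0
    have h1 := hgd (attachInl ζ (1 : A))
    rw [attachCocycle_apply, attachFst_inl, op_one, one_smul, attach_d_inl, hA.d_one, smul_zero,
      map_zero, zero_add, op_one, one_smul] at h1
    have hg1 : g (attachInl ζ (1 : A)) ∈ (C.attach ζ).gr (m - 2) :=
      hg (show m - 2 = m - 1 + -1 by omega) _
        (isHomogeneous_attachInl ζ (by omega) (1 : A) 𝒜.one_mem)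
    have h2 : attachFst ζ (g (attachInl ζ (1 : A))) = (0 : A) :=
      hA.eq_zero_of_neg (show (-1 : ℤ) < 0 by omega)
        (isHomogeneous_attachFst ζ (show -1 = m - 2 + (1 - m) by omega) _ hg1)
    have h3 := congrArg (attachSnd ζ) h1
    rw [map_add, attachSnd_d, h2, attachSnd_inr, op_zero, zero_smul, zero_add] at h3
    have h4 : p (attachSnd ζ (g (attachInr ζ ζ))) = 0 :=
      h.eq_zero_of_lt_apply (f := p ∘ₗ attachSnd ζ ∘ₗ g ∘ₗ attachInr ζ)
        (show -t - 1 < -t by omega)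
        (h.isHomogeneous.comp ((isHomogeneous_attachSnd ζ).comp
          (hg.comp (isHomogeneous_attachInr ζ) rfl) rfl) (by omega)) _
    rw [h3, map_add, h4, add_zero]
    refine h.map_mem_coboundaries (show m - 1 = t + (e - 1) by omega) ⟨_, ?_, rfl⟩
    exact isHomogeneous_attachSnd ζ (by omega) _ hg1
  · obtain ⟨w, hw, hdw⟩ := h.mem_coboundaries (e - 1) _ (by omega) hr _ φ.2 h0
    rw [show m - 1 - 1 = m - 2 by omega] at hw
    refine attach_homotopic_zero ζ (attachCocycle ζ φ) 0 (fun _ _ _ _ _ => Submodule.zero_mem _)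
      (fun y => ?_) (w := attachInr ζ w) (Hom.map_mem (C.toAttach ζ) hw) ?_
    · rw [attachCocycle_apply, attachFst_inr]
      change attachInr ζ (op (0 : A) • (φ : C)) = (C.attach ζ).d 0 + 0
      rw [op_zero, zero_smul, map_zero, map_zero, add_zero]
    · rw [attach_d_inr, hdw, attachCocycle_apply, attachFst_inl, op_one, one_smul]
      exact (sub_zero _).symm

/-- The endomorphisms of the mapping cone that vanish on `C` are those given by cocycles. -/
lemma exists_attachCocycleD_eq (h : IsTopCell C p t r) (hA : 𝒜.IsFiniteDimModel)
    (hG : 𝒜.IsGorenstein) (hm : m = t + e) (he : 2 ≤ e) (hr : r ≤ e - 1) (hed : e ≤ 𝒜.self.sup)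
    (hζ : (ζ : C) ∉ C.coboundaries m) {f : (C.attach ζ).EndD}
    (hf : (toDerived 𝒜).map (C.toAttach ζ) ≫ f.asHom = 0) :
    ∃ φ, attachCocycleD ζ φ = f := by
  have h' := h.attach ζ hA hG hm he hr hed hζ
  have hP := h'.isHProjective
  obtain ⟨a, rfl⟩ := hP.toDerived_map_surjective f
  have hf' : (toDerived 𝒜).map (C.toAttach ζ ≫ a) = 0 := ((toDerived 𝒜).map_comp _ _).trans hf
  rw [h.isHProjective.toDerived_map_eq_zero_iff] at hf'
  obtain ⟨b, hb⟩ := h.exists_restrict ζ hm he a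
  -- the scalar by which `a` acts on the last copy of `A` is zero
  have hb0 : Homotopic b 0 := h.homotopic_zero_of_comp_toAttach ζ hm he (hb ▸ hf')
  obtain ⟨c, hc⟩ := h'.exists_scalar a
  have hc0 : c = 0 := by
    obtain ⟨u, -, hu⟩ := h.exists_gen
    have h1 := h.scalar_eq_of_attach_end ζ hA hm (by omega) hζ hb hc u
    rw [h.map_eq_of_homotopic hb0 u, hu] at h1
    have h2 : c • (1 : A) = 0 := h1.symm.trans (map_zero p)
    exact (smul_eq_zero.1 h2).resolve_right hA.one_ne_zero
  subst hc0
  obtain ⟨θ, hθ, haθ, hdθ⟩ := exists_d_eq_of_attach_end ζ hA hb hc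
  rw [zero_smul, sub_zero] at hdθ
  obtain ⟨g, hg, hgd⟩ := (homotopic_zero_iff _).1 hf'
  have hgd' : ∀ y, lin a (attachInr ζ y) = (C.attach ζ).d (g y) + g (C.d y) := hgd
  have hg0 := h.attachFst_apply_eq_zero ζ hm he (by omega) hg
  have hbr : ∀ y, lin a (attachInr ζ y) = attachInr ζ (lin b y) :=
    fun y => LinearMap.congr_fun (congrArg Hom.lin hb) y
  have hζ0 : C.d ζ = 0 := ζ.2.2
  have hφ : θ - attachSnd ζ (g ζ) ∈ C.cocycles (m - 1) := by
    refine ⟨Submodule.sub_mem _ hθ ?_, ?_⟩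
    · exact isHomogeneous_attachSnd ζ (add_zero _).symm _ (hg (by omega) _ ζ.2.1)
    · have h1 := congrArg (attachSnd ζ) (hgd' ζ)
      rw [hbr, hζ0, map_zero, add_zero, attachSnd_d, hg0, attachSnd_inr] at h1
      have h2 : lin b (ζ : C) = C.d (attachSnd ζ (g ζ)) := by
        refine h1.trans ?_
        change op (0 : A) • (ζ : C) + _ = _
        rw [op_zero, zero_smul, zero_add]
      change C.d _ = 0
      rw [map_sub, hdθ, h2, sub_self]
  refine ⟨⟨_, hφ⟩, ?_⟩
  change (toDerived 𝒜).map (attachCocycle ζ ⟨_, hφ⟩) = (toDerived 𝒜).map a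
  refine Eq.symm ((hP.toDerived_map_eq_iff _ _).2 ((homotopic_iff_sub _ _).2 ?_))
  refine attach_homotopic_zero ζ _ g hg (fun y => ?_) (Submodule.zero_mem _) ?_
  · rw [sub_lin, attachCocycle_apply, attachFst_inr, ← hgd']
    change _ - attachInr ζ (op (0 : A) • _) = _
    rw [op_zero, zero_smul, map_zero, sub_zero]
  · rw [map_zero, sub_lin, attachCocycle_apply, attachFst_inl, op_one, one_smul]
    refine attach_ext ζ ?_ ?_
    · rw [map_sub, map_sub, hc, zero_smul, attachFst_inr, hg0, sub_zero, sub_zero, map_zero]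
    · rw [map_sub, map_sub, haθ, attachSnd_inr, map_zero]
      change 0 = θ - (θ - attachSnd ζ (g ζ)) - attachSnd ζ (g ζ)
      abel

/-- The kernel of the restriction to `C` is the cohomology of `A` in degree `e - 1`: both are
quotients of the cocycles of `C` of degree `m - 1` by the same subspace. -/
lemma exists_cohomology_equiv_ker (h : IsTopCell C p t r) (hA : 𝒜.IsFiniteDimModel)
    (hG : 𝒜.IsGorenstein) (hm : m = t + e) (he : 2 ≤ e) (hr : r ≤ e - 1) (hed : e ≤ 𝒜.self.sup)
    (hζ : (ζ : C) ∉ C.coboundaries m)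
    {ρ : (C.attach ζ).EndD →ₐ[k] C.EndD}
    (hρ : ∀ a, ρ a = 0 ↔ (toDerived 𝒜).map (C.toAttach ζ) ≫ a.asHom = 0) :
    Nonempty (𝒜.self.cohomology (e - 1) ≃ₗ[k] LinearMap.ker ρ.toLinearMap) := by
  have hm' : m - 1 = t + (e - 1) := by omega
  let π : C.cocycles (m - 1) →ₗ[k] 𝒜.self.cocycles (e - 1) :=
    { toFun := fun x => ⟨p x, h.map_mem_cocycles hm' x.2⟩
      map_add' := fun x y => Subtype.ext (map_add p _ _)
      map_smul' := fun c x => Subtype.ext (p.map_smul_of_tower c (x : C)) }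
  let F : C.cocycles (m - 1) →ₗ[k] 𝒜.self.cohomology (e - 1) := 𝒜.self.cls (e - 1) ∘ₗ π
  have hF : Function.Surjective F := fun y => by
    obtain ⟨y, rfl⟩ := cls_surjective (e - 1) y
    obtain ⟨x, hx, hxy⟩ := h.exists_cocycle (e - 1) (m - 1) hm' hr y y.2
    exact ⟨⟨x, hx⟩, congrArg (𝒜.self.cls (e - 1)) (Subtype.ext hxy)⟩
  let G : C.cocycles (m - 1) →ₗ[k] LinearMap.ker ρ.toLinearMap :=
    (attachCocycleD ζ).codRestrict _ fun φ => (hρ _).2 <| by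
      refine ((toDerived 𝒜).map_comp _ _).symm.trans ?_
      rw [h.isHProjective.toDerived_map_eq_zero_iff]
      have : C.toAttach ζ ≫ attachCocycle ζ φ = 0 := hom_ext fun y => by
        rw [comp_lin, attachCocycle_apply, attachFst_inr]
        change attachInr ζ (op (0 : A) • _) = 0
        rw [op_zero, zero_smul, map_zero]
      rw [this]
      exact (homotopic_iff _ _).2 ⟨0, fun _ _ _ _ _ => Submodule.zero_mem _, by simp⟩
  have hG : Function.Surjective G := fun y => by
    obtain ⟨φ, hφ⟩ := h.exists_attachCocycleD_eq ζ hA hG hm he hr hed hζ ((hρ _).1 y.2)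
    exact ⟨φ, Subtype.ext hφ⟩
  have hker : LinearMap.ker F = LinearMap.ker G := by
    ext φ
    refine (cls_eq_zero_iff (π φ)).trans
      ((h.attachCocycleD_eq_zero_iff ζ hA hm hr φ).symm.trans ?_)
    rw [LinearMap.mem_ker, ← Subtype.coe_inj]
    rfl
  exact ⟨(F.quotKerEquivOfSurjective hF).symm ≪≫ₗ Submodule.quotEquivOfEq _ _ hker ≪≫ₗ
    G.quotKerEquivOfSurjective hG⟩

/-- The endomorphism algebra of the mapping cone is a trivial extension. -/
lemma exists_endD_attach_equiv (h : IsTopCell C p t r) (hA : 𝒜.IsFiniteDimModel)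
    (hG : 𝒜.IsGorenstein) (hm : m = t + e) (he : 2 ≤ e) (hr : r ≤ e - 1) (hed : e ≤ 𝒜.self.sup)
    (hζ : (ζ : C) ∉ C.coboundaries m) :
    ∃ (_ : Module C.EndD (𝒜.self.cohomology (e - 1)))
      (_ : Module C.EndDᵐᵒᵖ (𝒜.self.cohomology (e - 1)))
      (_ : SMulCommClass C.EndD C.EndDᵐᵒᵖ (𝒜.self.cohomology (e - 1)))
      (_ : IsScalarTower k C.EndD (𝒜.self.cohomology (e - 1)))
      (_ : IsScalarTower k C.EndDᵐᵒᵖ (𝒜.self.cohomology (e - 1)))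
      (Φ : (C.attach ζ).EndD ≃ₐ[k] TrivSqZeroExt C.EndD (𝒜.self.cohomology (e - 1))),
      ∀ a : (C.attach ζ).EndD, (toDerived 𝒜).map (C.toAttach ζ) ≫ a.asHom =
        (Φ a).fst.asHom ≫ (toDerived 𝒜).map (C.toAttach ζ) := by
  have h' := h.attach ζ hA hG hm he hr hed hζ
  have hinj : ∀ b : (toDerived 𝒜).obj C ⟶ (toDerived 𝒜).obj C,
      b ≫ (toDerived 𝒜).map (C.toAttach ζ) = 0 → b = 0 := fun b hb => by
    obtain ⟨b, rfl⟩ := h.isHProjective.toDerived_map_surjective b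
    rw [← Functor.map_comp, h.isHProjective.toDerived_map_eq_zero_iff] at hb
    rw [h.isHProjective.toDerived_map_eq_zero_iff]
    exact h.homotopic_zero_of_comp_toAttach ζ hm he hb
  obtain ⟨ρ, hρ⟩ := exists_restrict_algHom (k := k) ((toDerived 𝒜).map (C.toAttach ζ)) hinj fun a => by
    obtain ⟨a, rfl⟩ := h'.isHProjective.toDerived_map_surjective a
    obtain ⟨b, hb⟩ := h.exists_restrict ζ hm he a
    exact ⟨(toDerived 𝒜).map b, by rw [← Functor.map_comp, hb, Functor.map_comp]⟩
  obtain ⟨ε, hε⟩ := h.exists_augmentation hA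
  have hρu : ∀ (a : (C.attach ζ).EndD) (b : C.EndD), (toDerived 𝒜).map (C.toAttach ζ) ≫ a.asHom =
      b.asHom ≫ (toDerived 𝒜).map (C.toAttach ζ) → ρ a = b := fun a b hab =>
    sub_eq_zero.1 (hinj (ρ a - b : C.EndD) <| (Preadditive.sub_comp ..).trans
      (sub_eq_zero.2 ((hρ a).symm.trans hab)))
  have hsurj : Function.Surjective ρ := fun f => by
    obtain ⟨b, rfl⟩ := h.isHProjective.toDerived_map_surjective f
    obtain ⟨c, hc⟩ := h.exists_scalar b
    obtain ⟨a, ha, -⟩ := h.exists_extend ζ hm (by omega) hc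
    exact ⟨End.of ((toDerived 𝒜).map a), hρu _ _ (((toDerived 𝒜).map_comp _ _).symm.trans
      ((congrArg (toDerived 𝒜).map ha).trans ((toDerived 𝒜).map_comp _ _)))⟩
  -- the augmentations of both algebras agree along `ρ`
  have hmul : ∀ x y, ε (ρ x) = 0 → ε (ρ y) = 0 → x * y = 0 := by
    obtain ⟨ε', hε'⟩ := h'.exists_augmentation hA
    have hεε : ∀ x, ε' x = ε (ρ x) := fun x => by
      obtain ⟨a, rfl⟩ := h'.isHProjective.toDerived_map_surjective x
      obtain ⟨b, hb⟩ := h.exists_restrict ζ hm he a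
      obtain ⟨u, -, hu⟩ := h.exists_gen
      have h1 := h.scalar_eq_of_attach_end ζ hA hm (by omega) hζ hb (hε' a) u
      rw [hε, hu] at h1
      have h2 : ρ (End.of ((toDerived 𝒜).map a)) = End.of ((toDerived 𝒜).map b) :=
        hρu _ _ (((toDerived 𝒜).map_comp _ _).symm.trans
          ((congrArg (toDerived 𝒜).map hb).trans ((toDerived 𝒜).map_comp _ _)))
      exact (smul_left_injective k hA.one_ne_zero h1).symm.trans (congrArg ε h2.symm)
    intro x y hx hy
    exact h'.augmentation_mul_eq_zero hε' x y ((hεε x).trans hx) ((hεε y).trans hy)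
  obtain ⟨ψ⟩ := h.exists_cohomology_equiv_ker ζ hA hG hm he hr hed hζ (ρ := ρ) fun a => by
    refine ⟨fun ha => ?_, fun ha => hρu a 0 (ha.trans Limits.zero_comp.symm)⟩
    rw [hρ, ha]
    exact Limits.zero_comp
  obtain ⟨i1, i2, i3, i4, i5, Φ, hΦ⟩ := exists_algEquiv_trivSqZeroExt ρ hsurj ε hmul ψ
  exact ⟨i1, i2, i3, i4, i5, Φ, fun a => by rw [hΦ, hρ]⟩

end Attach

end IsTopCell

end DGModule

/-! ### Objects obtained by construction steps -/

section Constructible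

variable {k : Type v} {A : Type u} [Field k] [Ring A] [Algebra k A] {𝒜 : DGAlgebra k A}

/-- The degrees of a construction step, in terms of the degree `t` of the last generator. -/
lemma DGModule.IsTopCell.stepDegree_spec {C : DGModule 𝒜} {p : C →ₗ[Aᵐᵒᵖ] 𝒜.self} {t r : ℤ}
    (h : C.IsTopCell p t r) (hA : 𝒜.IsFiniteDimModel) (hd : 2 ≤ 𝒜.self.sup) {e : ℤ}
    {last : Option StepKind} {κ : StepKind} (hκ : StepAllowed 𝒜 e last κ)
    (hr : r ≤ 𝒜.self.sup - 1) (hr' : last ≠ some .second → r ≤ 1) :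
    stepDegree e C κ = t + stepDegreeA e C κ ∧ 2 ≤ stepDegreeA e C κ ∧
      r ≤ stepDegreeA e C κ - 1 ∧ stepDegreeA e C κ ≤ 𝒜.self.sup ∧
      (κ = .first → stepDegreeA e C κ = 𝒜.self.sup) := by
  have hs := h.sup_eq hA
  cases κ with
  | first =>
    simp only [stepDegreeA, stepDegree, hs]
    exact ⟨by omega, by omega, by omega, by omega, fun _ => by omega⟩
  | second =>
    obtain ⟨h1, h2, -, h3⟩ := hκ
    have := hr' h3
    simp only [stepDegreeA, stepDegree, hs]
    exact ⟨by omega, by omega, by omega, by omega, nofun⟩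

lemma Constructible.exists_isTopCell (hA : 𝒜.IsFiniteDimModel) (hG : 𝒜.IsGorenstein)
    (hd : 2 ≤ 𝒜.self.sup) {e : ℤ} {n : ℕ} {last : Option StepKind} {C : DGModule 𝒜}
    (hC : Constructible 𝒜 e n last C) : ∃ (p : C →ₗ[Aᵐᵒᵖ] 𝒜.self) (t r : ℤ),
      C.IsTopCell p t r ∧ r ≤ 𝒜.self.sup - 1 ∧ (last ≠ some .second → r ≤ 1) := by
  induction hC with
  | zero => exact ⟨_, 0, 1, DGModule.isTopCell_self hA 1, by omega, fun _ => le_rfl⟩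
  | step _ κ hκ ζ hζ ih =>
    obtain ⟨p, t, r, h, hr, hr'⟩ := ih
    obtain ⟨h1, h2, h3, h4, h5⟩ := h.stepDegree_spec hA hd hκ hr hr'
    refine ⟨_, _, _, h.attach ζ hA hG h1 h2 h3 h4
      fun h0 => hζ ((DGModule.cls_eq_zero_iff _).2 h0), by omega, fun hne => ?_⟩
    cases κ with
    | first => have := h5 rfl; omega
    | second => exact absurd rfl hne

end Constructible

end

theorem proposition4p6 {k : Type v} {A : Type u} [Field k] [Ring A] [Algebra k A]
    (𝒜 : DGAlgebra k A) (hA : 𝒜.IsFiniteDimModel) (hG : 𝒜.IsGorenstein)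
    (hdim : 2 ≤ Module.rank k (DirectSum ℤ fun i => 𝒜.self.cohomology i)) (e : ℤ)
    {n : ℕ} {last : Option StepKind} {C : DGModule 𝒜} (hC : Constructible 𝒜 e n last C)
    (κ : StepKind) (hκ : StepAllowed 𝒜 e last κ)
    (ζ : C.cocycles (stepDegree e C κ)) (hζ : C.cls _ ζ ≠ 0) :
    (∃ (_ : Module C.EndD (𝒜.self.cohomology (stepDegreeA e C κ - 1)))
        (_ : Module C.EndDᵐᵒᵖ (𝒜.self.cohomology (stepDegreeA e C κ - 1)))
        (_ : SMulCommClass C.EndD C.EndDᵐᵒᵖ (𝒜.self.cohomology (stepDegreeA e C κ - 1)))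
        (_ : IsScalarTower k C.EndD (𝒜.self.cohomology (stepDegreeA e C κ - 1)))
        (_ : IsScalarTower k C.EndDᵐᵒᵖ (𝒜.self.cohomology (stepDegreeA e C κ - 1)))
        (Φ : (C.attach ζ).EndD ≃ₐ[k] TrivSqZeroExt C.EndD
          (𝒜.self.cohomology (stepDegreeA e C κ - 1))),
        ∀ a : (C.attach ζ).EndD,
          (DGModule.toDerived 𝒜).map (C.toAttach ζ) ≫ a.asHom =
            (Φ a).fst.asHom ≫ (DGModule.toDerived 𝒜).map (C.toAttach ζ)) ∧
      IsLocalRing (C.attach ζ).EndD ∧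
      IsIndecomposable ((DGModule.toDerived 𝒜).obj (C.attach ζ)) := by
  have hd := hA.two_le_sup hdim
  obtain ⟨p, t, r, h, hr, hr'⟩ := hC.exists_isTopCell hA hG hd
  obtain ⟨h1, h2, h3, h4, -⟩ := h.stepDegree_spec hA hd hκ hr hr'
  have hζ' : (ζ : C) ∉ C.coboundaries (stepDegree e C κ) :=
    fun h0 => hζ ((DGModule.cls_eq_zero_iff _).2 h0)
  have hloc := (h.attach ζ hA hG h1 h2 h3 h4 hζ').isLocalRing_endD hA
  exact ⟨h.exists_endD_attach_equiv ζ hA hG h1 h2 h3 h4 hζ', hloc,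
    IsIndecomposable.of_isLocalRing_end hloc⟩
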